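/- Let $n\ge 1$ and $m\ge 1$ be integers. In the (simultaneous) One Way 1-D Voronoi Game, maximization version, each of $n$ players is given $m$ points on the circle $\mathbb{R}/\mathbb{Z}$ of circumference $1$, and each player chooses one of their own $m$ points. A player then owns the arc that starts at their chosen point and continues clockwise until the next chosen point (the whole circle, if there is no other chosen point), and the player's utility is the length of this arc. A pure Nash equilibrium is a choice of one point by every player such that no player can strictly increase their utility by switching, alone, to another of their $m$ points. Suppose that the $nm$ given points are independent random variables, each uniformly distributed on the circle, and let $N$ be the number of pure Nash equilibria of the resulting game. Then $$0.19^{\,m-1}\, m\;\le\;\mathbb{E}[N]\;\le\; m .$$ -/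

import Mathlib

open MeasureTheory ProbabilityTheory

noncomputable section

/-- `s` is a pure Nash equilibrium of the game in which the strategies of every player are the
elements of `σ` and `u s i` is the utility of player `i` in the profile `s`: no player can
increase their utility by changing only their own strategy. -/
def IsPureNash {ι σ : Type*} [DecidableEq ι] (u : (ι → σ) → ι → ℝ) (s : ι → σ) : Prop :=
  ∀ (i : ι) (k : σ), u (Function.update s i k) i ≤ u s i

/-- The distance from `x` to `y` along the circle of circumference `1`, travelling clockwise (the
positive direction of `ℝ / ℤ` is called clockwise). It is the representative of `y - x` in
`(0, 1]`; in particular the way from `x` to `x` is one full turn. -/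
def clockwiseDist (x y : UnitAddCircle) : ℝ :=
  (AddCircle.equivIoc (1 : ℝ) 0 (y - x) : ℝ)

/-- The length of the arc owned by player `i` when the players have chosen the points `c j`: the
arc runs clockwise from `c i` to the next chosen point. The minimum includes `j = i`, which gives
the whole circle; this matters only if no other point of the circle is chosen. -/
def ownedArc {n : ℕ} (c : Fin n → UnitAddCircle) (i : Fin n) : ℝ :=
  Finset.univ.inf' ⟨i, Finset.mem_univ i⟩ (fun j => clockwiseDist (c i) (c j))

/-- The utilities of the maximization version of the One Way 1-D Simultaneous Voronoi Game in
which `p i k` is the `k`-th point available to player `i`. -/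
def oneWayUtility {n m : ℕ} (p : Fin n → Fin m → UnitAddCircle)
    (s : Fin n → Fin m) (i : Fin n) : ℝ :=
  ownedArc (fun j => p j (s j)) i

/-- The number of pure Nash equilibria (as strategy profiles) of the maximization version of the
One Way 1-D Simultaneous Voronoi Game with the points `p`. -/
def numPureNash {n m : ℕ} (p : Fin n → Fin m → UnitAddCircle) : ℕ :=
  {s : Fin n → Fin m | IsPureNash (oneWayUtility p) s}.ncard

end

/-! Put k = m - 1. By linearity E[N] is m^n times the probability that one fixed profile is an
equilibrium. Given the chosen points, this happens when each of the k other points of every player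
falls into that player's `nonImprovingSet`, so the probability is the integral of `equilibriumProb`
(`volume_isPureNash`, `integral_numPureNash`).

Let the chosen points cut the circle into arcs of lengths x_j. The owner of arc a gains nothing by
landing in arc l within distance x_a of its end, which gives total length T_a = ∑_l min(x_a, x_l)
(`minSum`). The arc that ends at the player's own point is exceptional, because its end disappears
with the move. Hence the non-improving set has measure between T_a - min(x_a, x_{a-1}) and T_a.

Upper bound: the arcs of uniform points are uniform on the simplex of total 1. Since the T_a are
homogeneous, that integral can be taken over totals below 1, at the price of a factor k + 1
(`lintegral_equilibriumProb`). For sorted x the T_a form a triangular linear image of x with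
determinant n!, which carries the sorted simplex onto the sorted unit cube. So in symmetric
integrals the T_a behave like independent uniforms, and ∏ T_a^k has mean (k + 1)^(-n)
(`factorial_mul_setLIntegral_prod_minSum`). Thus E[N] ≤ m^n (k + 1) (k + 1)^(-n) = m.

Lower bound: let r_a = min(x_a, x_{a-1}) / T_a ≤ 1/2, so that 1 - r_a ≥ 4^(-r_a). Over random
arrangements of the same arcs on the cycle the sum of the r_a has mean at most 1, so by convexity of
exp the correction costs at most a factor 4^(-k) (`factorial_mul_prod_minSum_le`), and 1/4 ≥ 0.19.
-/

open MeasureTheory ProbabilityTheory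
open scoped ENNReal

/-! ### Symmetric integrals and linear changes of variables. -/

/-- Relabelling the coordinates of `ℝⁿ` preserves Lebesgue measure. -/
theorem measurePreserving_comp_perm {n : ℕ} {α : Type*} [MeasureSpace α]
    [SigmaFinite (volume : Measure α)] (σ : Equiv.Perm (Fin n)) :
    MeasurePreserving (fun x : Fin n → α => x ∘ σ) := by
  have h := volume_measurePreserving_piCongrLeft (fun _ : Fin n => α) σ.symm
  suffices h' : (fun x : Fin n → α => x ∘ σ) =
      MeasurableEquiv.piCongrLeft (fun _ : Fin n => α) σ.symm by
    rw [h']; exact h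
  funext x i
  have := MeasurableEquiv.piCongrLeft_apply_apply (β := fun _ : Fin n => α) σ.symm x (σ i)
  simpa using this.symm

theorem measurableSet_strictMono (n : ℕ) : MeasurableSet {x : Fin n → ℝ | StrictMono x} := by
  have : {x : Fin n → ℝ | StrictMono x} = ⋂ i, ⋂ j, {x | i < j → x i < x j} := by
    ext x; simp [StrictMono]
  rw [this]
  refine MeasurableSet.iInter fun i => MeasurableSet.iInter fun j => ?_
  by_cases h : i < j
  · simpa [h] using measurableSet_lt (measurable_pi_apply i) (measurable_pi_apply j)
  · simp [h]

/-- Each coincidence of two coordinates is a proper subspace, hence null. -/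
theorem ae_injective (n : ℕ) : ∀ᵐ x : Fin n → ℝ, Function.Injective x := by
  have : ∀ i j : Fin n, i ≠ j → ∀ᵐ x : Fin n → ℝ, x i ≠ x j := by
    intro i j hij
    let S : Submodule ℝ (Fin n → ℝ) :=
      LinearMap.ker (LinearMap.proj (R := ℝ) (φ := fun _ : Fin n => ℝ) i - LinearMap.proj j)
    have hS : S ≠ ⊤ := by
      intro h
      have h1 : (Pi.single i 1 : Fin n → ℝ) ∈ S := h ▸ Submodule.mem_top
      simp [S, LinearMap.mem_ker, hij.symm] at h1
    have h0 := Measure.addHaar_submodule (volume : Measure (Fin n → ℝ)) S hS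
    rw [ae_iff]
    convert h0 using 2
    ext x
    simp [S, LinearMap.mem_ker, sub_eq_zero]
  have h2 : ∀ᵐ x : Fin n → ℝ, ∀ i j : Fin n, i ≠ j → x i ≠ x j := by
    rw [ae_all_iff]; intro i
    rw [ae_all_iff]; intro j
    by_cases h : i = j
    · simp [h]
    · filter_upwards [this i j h] with x hx _ using hx
  filter_upwards [h2] with x hx i j hij
  by_contra h
  exact hx i j h hij

/-- The integral of a symmetric function is `n!` times its integral over increasing tuples. -/
theorem lintegral_eq_factorial_mul_setLIntegral_strictMono {n : ℕ} {f : (Fin n → ℝ) → ℝ≥0∞}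
    (hf : Measurable f) (hsymm : ∀ (σ : Equiv.Perm (Fin n)) x, f (x ∘ σ) = f x) :
    ∫⁻ x, f x = n.factorial * ∫⁻ x in {x | StrictMono x}, f x := by
  let A : Equiv.Perm (Fin n) → Set (Fin n → ℝ) := fun σ => {x | StrictMono (x ∘ σ)}
  have hA : ∀ σ, MeasurableSet (A σ) := fun σ =>
    (measurePreserving_comp_perm σ).measurable (measurableSet_strictMono n)
  have hdisj : Pairwise (Function.onFun Disjoint A) := by
    intro σ τ hst
    refine Set.disjoint_left.2 fun x hx hy => hst ?_
    have hx' : StrictMono (x ∘ σ) := hx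
    have hy' : StrictMono (x ∘ τ) := hy
    have hinj : Function.Injective x := by
      have := hx'.injective.comp σ.symm.injective
      rwa [Function.comp_assoc, Equiv.self_comp_symm, Function.comp_id] at this
    have : x ∘ σ = x ∘ τ := by
      refine StrictMono.range_inj hx' hy' |>.1 ?_
      rw [Set.range_comp, Set.range_comp, σ.surjective.range_eq, τ.surjective.range_eq]
    exact Equiv.ext fun i => hinj (congrFun this i)
  -- Tuples with repeated entries lie in no `A σ`, so the cones cover only almost everywhere.
  have hcover : (⋃ σ, A σ) =ᵐ[volume] (Set.univ : Set (Fin n → ℝ)) := by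
    rw [Filter.eventuallyEq_univ]
    filter_upwards [ae_injective n] with x hx
    refine Set.mem_iUnion.2 ⟨Tuple.sort x, ?_⟩
    exact (Tuple.monotone_sort x).strictMono_of_injective (hx.comp (Equiv.injective _))
  calc ∫⁻ x, f x = ∫⁻ x in ⋃ σ, A σ, f x := by
        rw [setLIntegral_congr hcover, setLIntegral_univ]
    _ = ∑ σ, ∫⁻ x in A σ, f x := by
        rw [lintegral_iUnion hA hdisj, tsum_fintype]
    _ = ∑ _σ : Equiv.Perm (Fin n), ∫⁻ x in {x | StrictMono x}, f x := by
        refine Finset.sum_congr rfl fun σ _ => ?_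
        rw [← (measurePreserving_comp_perm σ).setLIntegral_comp_preimage
          (measurableSet_strictMono n) hf]
        exact lintegral_congr fun x => (hsymm σ x).symm
    _ = _ := by simp [Fintype.card_perm]

/-- Linear change of variables for the Lebesgue integral. -/
theorem lintegral_mulVec {n : ℕ} (A : Matrix (Fin n) (Fin n) ℝ) (hA : A.det ≠ 0)
    {g : (Fin n → ℝ) → ℝ≥0∞} (hg : Measurable g) :
    ∫⁻ x, g (A.mulVec x) = ENNReal.ofReal |A.det|⁻¹ * ∫⁻ x, g x := by
  have h := Real.map_matrix_volume_pi_eq_smul_volume_pi hA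
  have hm : Measurable (Matrix.toLin' A) := (LinearMap.continuous_on_pi _).measurable
  have h2 := lintegral_map (μ := volume) hg hm
  rw [h, lintegral_smul_measure, abs_inv] at h2
  simpa using h2.symm

/-- The integral of a product of functions of one coordinate each. -/
theorem lintegral_pi_prod {n : ℕ} {α : Type*} [MeasureSpace α] [SigmaFinite (volume : Measure α)]
    {f : α → ℝ≥0∞} (hf : Measurable f) :
    ∫⁻ x : Fin n → α, ∏ i, f (x i) = (∫⁻ x, f x) ^ n := by
  induction n with
  | zero => simp [lintegral_unique, Measure.volume_pi_eq_dirac (fun i => Fin.elim0 i)]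
  | succ n ih =>
    have h := (volume_preserving_piFinSuccAbove (fun _ : Fin (n + 1) => α) 0).symm
    rw [← h.lintegral_comp (by fun_prop)]
    simp only [MeasurableEquiv.piFinSuccAbove_symm_apply, Fin.prod_univ_succ,
      Fin.insertNthEquiv_apply, Fin.insertNth_zero', Fin.cons_zero, Fin.cons_succ]
    have hg : Measurable fun y : Fin n → α => ∏ i, f (y i) := by fun_prop
    rw [Measure.volume_eq_prod, lintegral_prod_mul hf.aemeasurable hg.aemeasurable, ih, pow_succ']

/-! ### The law of `minSum` on the simplex. -/

/-- The sum over `j` of `min (x i) (x j)`. -/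
def minSum {n : ℕ} (x : Fin n → ℝ) (i : Fin n) : ℝ := ∑ j, min (x i) (x j)

/-- The tuples of positive reals with sum less than one. -/
def openSimplex (n : ℕ) : Set (Fin n → ℝ) := {x | (∀ i, 0 < x i) ∧ ∑ i, x i < 1}

theorem measurable_minSum {n : ℕ} (i : Fin n) : Measurable fun x : Fin n → ℝ => minSum x i := by
  unfold minSum; fun_prop

theorem measurableSet_openSimplex (n : ℕ) : MeasurableSet (openSimplex n) := by
  have : openSimplex n = (⋂ i, {x | 0 < x i}) ∩ {x | ∑ i, x i < 1} := by
    ext x; simp [openSimplex]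
  rw [this]
  exact (MeasurableSet.iInter fun i => measurableSet_lt measurable_const
    (measurable_pi_apply i)).inter (measurableSet_lt (by fun_prop) measurable_const)

theorem minSum_comp_perm {n : ℕ} (σ : Equiv.Perm (Fin n)) (x : Fin n → ℝ) (i : Fin n) :
    minSum (x ∘ σ) i = minSum x (σ i) :=
  Equiv.sum_comp σ fun j => min (x (σ i)) (x j)

theorem comp_perm_mem_openSimplex {n : ℕ} (σ : Equiv.Perm (Fin n)) (x : Fin n → ℝ) :
    x ∘ σ ∈ openSimplex n ↔ x ∈ openSimplex n := by
  simp only [openSimplex, Set.mem_ofPred_eq, Function.comp_apply]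
  rw [Equiv.sum_comp σ x]
  refine and_congr_left fun _ => ⟨fun h i => ?_, fun h i => h _⟩
  simpa using h (σ.symm i)

/-- On increasing tuples `minSum` is given by this lower triangular matrix. -/
def minSumMatrix (n : ℕ) : Matrix (Fin n) (Fin n) ℝ :=
  fun i j => if j < i then 1 else if j = i then (n - i : ℕ) else 0

theorem det_minSumMatrix (n : ℕ) : (minSumMatrix n).det = n.factorial := by
  rw [Matrix.det_of_isLowerTriangular]
  · simp only [minSumMatrix, lt_irrefl, if_false, if_true]
    rw [← Nat.cast_prod, Finset.prod_fin_eq_prod_range, ← Finset.prod_range_add_one_eq_factorial,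
      ← Finset.prod_range_reflect (fun i => i + 1)]
    congr 1
    refine Finset.prod_congr rfl fun i hi => ?_
    have := Finset.mem_range.1 hi
    simp only [this, dite_true]; omega
  · intro i j hij
    have : i < j := hij
    simp [minSumMatrix, this.not_gt, this.ne']

theorem minSumMatrix_mulVec {n : ℕ} (x : Fin n → ℝ) (i : Fin n) :
    (minSumMatrix n).mulVec x i = ∑ j ∈ Finset.Iio i, x j + (n - i : ℕ) * x i := by
  simp only [Matrix.mulVec, dotProduct, minSumMatrix, ite_mul, one_mul, zero_mul]
  have h : ∀ j, (if j < i then x j else if j = i then ((n - i : ℕ) : ℝ) * x j else 0) =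
      (if j < i then x j else 0) + (if j = i then ((n - i : ℕ) : ℝ) * x j else 0) := by
    intro j
    by_cases h1 : j < i
    · simp [h1, h1.ne]
    · simp [h1]
  rw [Finset.sum_congr rfl fun j _ => h j, Finset.sum_add_distrib, ← Finset.sum_filter,
    Finset.sum_ite_eq' Finset.univ i, if_pos (Finset.mem_univ i)]
  congr 2
  ext; simp

theorem minSum_eq_mulVec {n : ℕ} {x : Fin n → ℝ} (hx : StrictMono x) (i : Fin n) :
    minSum x i = (minSumMatrix n).mulVec x i := by
  rw [minSumMatrix_mulVec, minSum]
  have h : ∀ j, min (x i) (x j) = (if j < i then x j else 0) + if i ≤ j then x i else 0 := by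
    intro j
    rcases lt_or_ge j i with h | h
    · simp [h, h.not_ge, (hx h).le]
    · simp [h, h.not_gt, hx.monotone h]
  rw [Finset.sum_congr rfl fun j _ => h j, Finset.sum_add_distrib, ← Finset.sum_filter,
    ← Finset.sum_filter, Finset.sum_const, nsmul_eq_mul]
  have h1 : Finset.univ.filter (fun j => j < i) = Finset.Iio i := by ext; simp
  have h2 : Finset.univ.filter (fun j => i ≤ j) = Finset.Ici i := by ext; simp
  rw [h1, h2, Fin.card_Ici]

theorem Fin.sum_Iio_succ {N : ℕ} (x : Fin (N + 1) → ℝ) (i : Fin N) :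
    ∑ j ∈ Finset.Iio i.succ, x j = ∑ j ∈ Finset.Iio i.castSucc, x j + x i.castSucc := by
  have : Finset.Iio i.succ = insert i.castSucc (Finset.Iio i.castSucc) := by
    ext j; simp only [Finset.mem_Iio, Finset.mem_insert, Fin.lt_def, Fin.ext_iff, Fin.val_succ,
      Fin.val_castSucc]; omega
  rw [this, Finset.sum_insert (by simp), add_comm]

/-- Consecutive gaps are multiplied by positive factors, which is why the map preserves and reflects
order. -/
theorem minSumMatrix_mulVec_succ_sub {N : ℕ} (x : Fin (N + 1) → ℝ) (i : Fin N) :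
    (minSumMatrix (N + 1)).mulVec x i.succ - (minSumMatrix (N + 1)).mulVec x i.castSucc =
      (N - i : ℕ) * (x i.succ - x i.castSucc) := by
  rw [minSumMatrix_mulVec, minSumMatrix_mulVec, Fin.sum_Iio_succ]
  have h1 : N + 1 - (i.succ : ℕ) = N - i := by simp
  have h2 : N + 1 - (i.castSucc : ℕ) = (N - i) + 1 := by
    have := i.2; simp; omega
  rw [h1, h2]; push_cast; ring

theorem strictMono_minSumMatrix_mulVec_iff {N : ℕ} (x : Fin (N + 1) → ℝ) :
    StrictMono ((minSumMatrix (N + 1)).mulVec x) ↔ StrictMono x := by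
  rw [Fin.strictMono_iff_lt_succ, Fin.strictMono_iff_lt_succ]
  refine forall_congr' fun i => ?_
  rw [← sub_pos, minSumMatrix_mulVec_succ_sub, ← sub_pos (b := x i.castSucc)]
  have : (0 : ℝ) < (N - i : ℕ) := by exact_mod_cast Nat.sub_pos_of_lt i.2
  exact mul_pos_iff_of_pos_left this

theorem StrictMono.forall_pos_iff {N : ℕ} {x : Fin (N + 1) → ℝ} (hx : StrictMono x) :
    (∀ i, 0 < x i) ↔ 0 < x 0 :=
  ⟨fun h => h 0, fun h i => h.trans_le (hx.monotone (Fin.zero_le i))⟩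

theorem StrictMono.forall_lt_iff {N : ℕ} {x : Fin (N + 1) → ℝ} (hx : StrictMono x) (a : ℝ) :
    (∀ i, x i < a) ↔ x (Fin.last N) < a :=
  ⟨fun h => h _, fun h i => (hx.monotone (Fin.le_last i)).trans_lt h⟩

/-- For sorted tuples only the extreme entries matter. The first entry of the image is (N + 1) * x 0
and the last is the sum of x, so positivity and total below 1 become the two bounds of the unit
cube. -/
theorem strictMono_and_mem_openSimplex_iff {N : ℕ} (x : Fin (N + 1) → ℝ) :
    (StrictMono x ∧ x ∈ openSimplex (N + 1)) ↔
      (StrictMono ((minSumMatrix (N + 1)).mulVec x) ∧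
        ∀ i, (minSumMatrix (N + 1)).mulVec x i ∈ Set.Ioo (0 : ℝ) 1) := by
  rw [strictMono_minSumMatrix_mulVec_iff]
  refine and_congr_right fun hx => ?_
  have hT := (strictMono_minSumMatrix_mulVec_iff x).2 hx
  simp only [openSimplex, Set.mem_ofPred_eq, Set.mem_Ioo, forall_and]
  rw [hx.forall_pos_iff, hT.forall_pos_iff, hT.forall_lt_iff]
  have h0 : (minSumMatrix (N + 1)).mulVec x 0 = (N + 1) * x 0 := by
    rw [minSumMatrix_mulVec]; simp [show (Finset.Iio (0 : Fin (N + 1))) = ∅ by ext; simp]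
  have h1 : (minSumMatrix (N + 1)).mulVec x (Fin.last N) = ∑ i, x i := by
    rw [← minSum_eq_mulVec hx, minSum]
    exact Finset.sum_congr rfl fun j _ => min_eq_right (hx.monotone (Fin.le_last j))
  rw [h0, h1]
  have : (0 : ℝ) < N + 1 := by positivity
  rw [mul_pos_iff_of_pos_left this]

theorem setLIntegral_Ioo_ofReal_pow (k : ℕ) :
    ∫⁻ t in Set.Ioo (0 : ℝ) 1, ENNReal.ofReal t ^ k = ((k : ℝ≥0∞) + 1)⁻¹ := by
  have h : ∫⁻ t in Set.Ioo (0 : ℝ) 1, ENNReal.ofReal t ^ k =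
      ∫⁻ t in Set.Ioc (0 : ℝ) 1, ENNReal.ofReal (t ^ k) := by
    rw [setLIntegral_congr Ioo_ae_eq_Ioc]
    exact setLIntegral_congr_fun measurableSet_Ioc fun t ht =>
      (ENNReal.ofReal_pow ht.1.le k).symm
  rw [h, ← ofReal_integral_eq_lintegral_ofReal, ← intervalIntegral.integral_of_le zero_le_one,
    integral_pow]
  · rw [one_pow, zero_pow k.succ_ne_zero, sub_zero, one_div, ENNReal.ofReal_inv_of_pos (by positivity)]
    congr 1
    rw [ENNReal.ofReal_add (by positivity) zero_le_one]; simp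
  · exact ((continuous_pow k).integrableOn_Icc).mono_set Set.Ioc_subset_Icc_self
  · exact (ae_restrict_iff' measurableSet_Ioc).2 (.of_forall fun t ht => pow_nonneg ht.1.le k)

/-- The normalized spacings of a uniform point of the simplex are again uniform; in particular
the values of `minSum` are distributed like independent uniform variables. -/
theorem factorial_mul_setLIntegral_prod_minSum (N k : ℕ) :
    ((N + 1).factorial : ℝ≥0∞) *
      ∫⁻ x in openSimplex (N + 1), ∏ i, ENNReal.ofReal (minSum x i) ^ k =
      ((k : ℝ≥0∞) + 1)⁻¹ ^ (N + 1) := by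
  set n := N + 1 with hn
  let f : (Fin n → ℝ) → ℝ≥0∞ :=
    (openSimplex n).indicator fun x => ∏ i, ENNReal.ofReal (minSum x i) ^ k
  let φ : ℝ → ℝ≥0∞ := (Set.Ioo (0 : ℝ) 1).indicator fun t => ENNReal.ofReal t ^ k
  have hφ : Measurable φ := (by fun_prop : Measurable fun t => ENNReal.ofReal t ^ k).indicator
    measurableSet_Ioo
  let h : (Fin n → ℝ) → ℝ≥0∞ := fun t => ∏ i, φ (t i)
  have hh : Measurable h := by fun_prop
  let g : (Fin n → ℝ) → ℝ≥0∞ := {t | StrictMono t}.indicator h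
  have hg : Measurable g := hh.indicator (measurableSet_strictMono n)
  have hf : Measurable f := by
    refine Measurable.indicator ?_ (measurableSet_openSimplex n)
    have := @measurable_minSum n
    fun_prop
  have hfs : ∀ (σ : Equiv.Perm (Fin n)) x, f (x ∘ σ) = f x := by
    intro σ x
    by_cases hx : x ∈ openSimplex n
    · simp only [f]
      rw [Set.indicator_of_mem hx, Set.indicator_of_mem ((comp_perm_mem_openSimplex σ x).2 hx)]
      simp only [minSum_comp_perm]
      exact Equiv.prod_comp σ fun i => ENNReal.ofReal (minSum x i) ^ k
    · simp only [f]
      rw [Set.indicator_of_notMem hx,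
        Set.indicator_of_notMem (mt (comp_perm_mem_openSimplex σ x).1 hx)]
  have hhs : ∀ (σ : Equiv.Perm (Fin n)) x, h (x ∘ σ) = h x := fun σ x =>
    Equiv.prod_comp σ fun i => φ (x i)
  have hfg : ∀ x, {x | StrictMono x}.indicator f x = g ((minSumMatrix n).mulVec x) := by
    intro x
    by_cases hx : StrictMono x ∧ x ∈ openSimplex n
    · have hx' := (strictMono_and_mem_openSimplex_iff x).1 hx
      rw [Set.indicator_of_mem (show x ∈ {x | StrictMono x} from hx.1)]
      refine (Set.indicator_of_mem hx.2 _).trans ?_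
      refine Eq.trans ?_ (Set.indicator_of_mem
        (show (minSumMatrix n).mulVec x ∈ {x | StrictMono x} from hx'.1) h).symm
      refine Finset.prod_congr rfl fun i _ => ?_
      rw [minSum_eq_mulVec hx.1]
      exact (Set.indicator_of_mem (hx'.2 i) fun t => ENNReal.ofReal t ^ k).symm
    · have hx' := mt (strictMono_and_mem_openSimplex_iff x).2 hx
      have h1 : {x | StrictMono x}.indicator f x = 0 := by
        rw [show {x | StrictMono x}.indicator f = _ from Set.indicator_indicator _ _ _]
        exact Set.indicator_of_notMem (s := {x | StrictMono x} ∩ openSimplex n) hx _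
      rw [h1]
      simp only [g, Set.indicator_apply, Set.mem_ofPred_eq]
      split_ifs with h2
      · have : ∃ i, (minSumMatrix n).mulVec x i ∉ Set.Ioo (0 : ℝ) 1 := by
          by_contra! h3; exact hx' ⟨h2, h3⟩
        obtain ⟨i, hi⟩ := this
        exact (Finset.prod_eq_zero (Finset.mem_univ i) (Set.indicator_of_notMem hi _)).symm
      · rfl
  have hfact : (0 : ℝ) < n.factorial := by exact_mod_cast n.factorial_pos
  rw [← lintegral_indicator (measurableSet_openSimplex n)]
  change _ * ∫⁻ x, f x = _
  rw [lintegral_eq_factorial_mul_setLIntegral_strictMono hf hfs,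
    ← lintegral_indicator (measurableSet_strictMono n), lintegral_congr hfg,
    lintegral_mulVec _ (by rw [det_minSumMatrix]; exact hfact.ne') hg, det_minSumMatrix,
    abs_of_pos hfact, ENNReal.ofReal_inv_of_pos hfact, ENNReal.ofReal_natCast]
  have hne : (n.factorial : ℝ≥0∞) ≠ 0 := by exact_mod_cast n.factorial_ne_zero
  -- One n! is given, one comes from sorting, and the determinant contributes its inverse; the n!
  -- that survives is spent on unsorting the cube.
  have hcancel : ∀ a : ℝ≥0∞, (n.factorial : ℝ≥0∞) * (n.factorial * ((n.factorial : ℝ≥0∞)⁻¹ * a)) =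
      n.factorial * a := by
    intro a
    rw [← mul_assoc (n.factorial : ℝ≥0∞) (_)⁻¹, ENNReal.mul_inv_cancel hne (ENNReal.natCast_ne_top _),
      one_mul]
  rw [hcancel, lintegral_indicator (measurableSet_strictMono n),
    ← lintegral_eq_factorial_mul_setLIntegral_strictMono hh hhs, lintegral_pi_prod hφ,
    lintegral_indicator measurableSet_Ioo, setLIntegral_Ioo_ofReal_pow]

/-! ### Random cyclic arrangements and the loss of a factor 4^k. -/

/-- Averaging a function of two different entries over all permutations. -/
theorem card_mul_sum_perm_apply_pair {α : Type*} [Fintype α] [DecidableEq α] (φ : α → α → ℝ)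
    {p q : α} (hpq : p ≠ q) :
    (Fintype.card α * (Fintype.card α - 1) : ℝ) * ∑ σ : Equiv.Perm α, φ (σ p) (σ q) =
      (Fintype.card α).factorial * ∑ a, ∑ b ∈ Finset.univ.erase a, φ a b := by
  have key : ∀ a, ∀ b ∈ Finset.univ.erase a,
      ∑ σ : Equiv.Perm α, φ (σ a) (σ b) = ∑ σ : Equiv.Perm α, φ (σ p) (σ q) := by
    intro a b hb
    have hab : b ≠ a := Finset.ne_of_mem_erase hb
    -- Relabelling by a permutation that takes (a, b) to (p, q) shows that all ordered pairs have
    -- the same sum.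
    let τ : Equiv.Perm α := Equiv.swap (Equiv.swap a p b) q * Equiv.swap a p
    have ha : τ a = p := by
      have h1 : p ≠ Equiv.swap a p b := fun h => hab <| by
        have := (Equiv.swap a p).injective ((Equiv.swap_apply_left a p).trans h)
        exact this.symm
      simp [τ, Equiv.swap_apply_of_ne_of_ne h1 hpq]
    have hb : τ b = q := by simp [τ]
    rw [← Equiv.sum_comp (Equiv.mulRight τ)]
    simp [ha, hb]
  have h1 : ∑ a, ∑ b ∈ Finset.univ.erase a, ∑ σ : Equiv.Perm α, φ (σ a) (σ b) =
      (Fintype.card α * (Fintype.card α - 1) : ℝ) * ∑ σ : Equiv.Perm α, φ (σ p) (σ q) := by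
    rw [Finset.sum_congr rfl fun a _ => Finset.sum_congr rfl (key a)]
    have hc : 1 ≤ Fintype.card α := Fintype.card_pos_iff.2 ⟨p⟩
    simp [Finset.card_erase_of_mem, Nat.cast_sub hc, mul_assoc]
  have h2 : ∑ a, ∑ b ∈ Finset.univ.erase a, ∑ σ : Equiv.Perm α, φ (σ a) (σ b) =
      ∑ σ : Equiv.Perm α, ∑ a, ∑ b ∈ Finset.univ.erase a, φ a b := by
    rw [Finset.sum_congr rfl fun a _ => Finset.sum_comm, Finset.sum_comm]
    refine Finset.sum_congr rfl fun σ _ => ?_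
    rw [← Equiv.sum_comp σ fun a => ∑ b ∈ Finset.univ.erase a, φ a b]
    refine Finset.sum_congr rfl fun a _ => ?_
    refine Finset.sum_bij (fun b _ => σ b) ?_ (fun _ _ _ _ h => σ.injective h) ?_ (fun _ _ => rfl)
    · intro b hb; simpa using Finset.ne_of_mem_erase hb
    · intro b hb
      exact ⟨σ.symm b, by simpa [Equiv.symm_apply_eq] using Finset.ne_of_mem_erase hb, by simp⟩
  rw [← h1, h2, Finset.sum_const, Finset.card_univ, Fintype.card_perm, nsmul_eq_mul]

theorem le_minSum {n : ℕ} {x : Fin n → ℝ} (hx : ∀ i, 0 < x i) (i : Fin n) : x i ≤ minSum x i := by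
  have := Finset.single_le_sum (f := fun j => min (x i) (x j))
    (fun j _ => (lt_min (hx i) (hx j)).le) (Finset.mem_univ i)
  simpa [minSum] using this

theorem minSum_pos {n : ℕ} {x : Fin n → ℝ} (hx : ∀ i, 0 < x i) (i : Fin n) : 0 < minSum x i :=
  (hx i).trans_le (le_minSum hx i)

theorem minSum_le {n : ℕ} (x : Fin n → ℝ) (i : Fin n) : minSum x i ≤ n * x i := by
  have := Finset.sum_le_card_nsmul Finset.univ (fun j => min (x i) (x j)) (x i)
    fun j _ => min_le_left _ _
  simpa [minSum] using this

/-- The terms at i and at j are each at least the minimum. This puts the ratios r into [0, 1/2], the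
range of `exp_neg_mul_log_four_le`. -/
theorem two_mul_min_le_minSum {n : ℕ} {x : Fin n → ℝ} (hx : ∀ i, 0 < x i) {i j : Fin n}
    (hij : i ≠ j) : 2 * min (x i) (x j) ≤ minSum x i := by
  have h := Finset.sum_le_sum_of_subset_of_nonneg (f := fun l => min (x i) (x l))
    (Finset.subset_univ {i, j}) fun l _ _ => (lt_min (hx i) (hx l)).le
  rw [Finset.sum_pair hij, min_self] at h
  have := min_le_left (x i) (x j)
  unfold minSum; linarith

theorem exp_neg_mul_log_four_le {r : ℝ} (h0 : 0 ≤ r) (h1 : r ≤ 1 / 2) :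
    Real.exp (-(r * Real.log 4)) ≤ 1 - r := by
  have h := convexOn_exp.2 (Set.mem_univ 0) (Set.mem_univ (-Real.log 2))
    (by linarith : 0 ≤ 1 - 2 * r) (by linarith : 0 ≤ 2 * r) (by ring)
  have h4 : Real.log 4 = 2 * Real.log 2 := by
    rw [show (4 : ℝ) = 2 ^ 2 by norm_num, Real.log_pow]; norm_num
  rw [h4]
  simp only [smul_eq_mul, mul_zero, zero_add, Real.exp_zero, Real.exp_neg,
    Real.exp_log (show (0 : ℝ) < 2 by norm_num)] at h
  calc Real.exp (-(r * (2 * Real.log 2))) = Real.exp (2 * r * -Real.log 2) := by ring_nf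
    _ ≤ _ := h
    _ = 1 - r := by ring

/-- Averaged over all arrangements of `x` on a cycle, removing from every `minSum` the term of the
cyclic predecessor costs at most a factor `4 ^ k`. -/
theorem factorial_mul_prod_minSum_le {N : ℕ} (k : ℕ) {x : Fin (N + 2) → ℝ} (hx : ∀ i, 0 < x i) :
    (N + 2).factorial * ((1 / 4) ^ k * ∏ i, minSum x i ^ k) ≤
      ∑ σ : Equiv.Perm (Fin (N + 2)), ∏ i, (minSum (x ∘ σ) (i + 1) -
        min ((x ∘ σ) (i + 1)) ((x ∘ σ) i)) ^ k := by
  let r : Fin (N + 2) → Fin (N + 2) → ℝ := fun a b => min (x a) (x b) / minSum x a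
  let R : Equiv.Perm (Fin (N + 2)) → ℝ := fun σ => ∑ i, r (σ (i + 1)) (σ i)
  have hT := minSum_pos hx
  have hr0 : ∀ a b, 0 ≤ r a b := fun a b => div_nonneg (lt_min (hx a) (hx b)).le (hT a).le
  have hr1 : ∀ a b, a ≠ b → r a b ≤ 1 / 2 := fun a b hab => by
    rw [div_le_iff₀ (hT a)]; linarith [two_mul_min_le_minSum hx hab]
  -- The mean of R is at most 1. For fixed a the r a b with b ≠ a sum to 1 - x a / T_a ≤ 1 - 1/n, so
  -- all ordered pairs together give at most n - 1. Each of the n cyclic positions carries a uniform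
  -- one of the n(n - 1) ordered pairs.
  have hR : ∑ σ, R σ ≤ (N + 2).factorial := by
    have hsum : ∑ a, ∑ b ∈ Finset.univ.erase a, r a b ≤ N + 1 := by
      have h1 : ∀ a, ∑ b ∈ Finset.univ.erase a, r a b ≤ 1 - 1 / (N + 2) := by
        intro a
        rw [Finset.sum_erase_eq_sub (Finset.mem_univ a), ← Finset.sum_div]
        change minSum x a / minSum x a - min (x a) (x a) / minSum x a ≤ _
        rw [div_self (hT a).ne', min_self]
        have h2 : 1 / ((N : ℝ) + 2) ≤ x a / minSum x a := by
          rw [div_le_div_iff₀ (by positivity) (hT a)]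
          have := minSum_le x a
          push_cast at this; linarith
        linarith
      refine (Finset.sum_le_card_nsmul _ _ _ fun a _ => h1 a).trans_eq ?_
      simp; field_simp; ring
    have hpair : ∀ i : Fin (N + 2), ∑ σ : Equiv.Perm (Fin (N + 2)), r (σ (i + 1)) (σ i) ≤
        (N + 2).factorial / (N + 2) := by
      intro i
      have h := card_mul_sum_perm_apply_pair r (p := i + 1) (q := i) (by simp)
      rw [Fintype.card_fin] at h
      rw [le_div_iff₀ (by positivity)]
      have h3 := mul_le_mul_of_nonneg_left hsum (Nat.cast_nonneg (α := ℝ) (N + 2).factorial)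
      rw [← h] at h3
      push_cast at h3
      have h4 : (0 : ℝ) < N + 1 := by positivity
      refine le_of_mul_le_mul_right ?_ h4
      linarith
    change ∑ σ : Equiv.Perm (Fin (N + 2)), ∑ i, r (σ (i + 1)) (σ i) ≤ _
    rw [Finset.sum_comm]
    refine (Finset.sum_le_card_nsmul _ _ _ fun i _ => hpair i).trans_eq ?_
    simp; field_simp
  have hlog : 0 ≤ Real.log 4 := Real.log_nonneg (by norm_num)
  have hquarter : Real.exp (-Real.log 4) = 1 / 4 := by
    rw [Real.exp_neg, Real.exp_log (by norm_num)]; norm_num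
  have hP : 0 ≤ ∏ i, minSum x i ^ k := Finset.prod_nonneg fun i _ => pow_nonneg (hT i).le k
  -- The tangent bound 1 + y ≤ exp y at y = k log 4 (1 - R σ) plays the role of Jensen's inequality:
  -- its right side is linear in R, so only the mean of R is needed afterwards.
  have hterm : ∀ σ : Equiv.Perm (Fin (N + 2)),
      (1 / 4) ^ k * (∏ i, minSum x i ^ k) * (1 + k * Real.log 4 * (1 - R σ)) ≤
        ∏ i, (minSum (x ∘ σ) (i + 1) - min ((x ∘ σ) (i + 1)) ((x ∘ σ) i)) ^ k := by
    intro σ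
    have hshift : ∏ i, minSum x (σ (i + 1)) ^ k = ∏ i, minSum x i ^ k :=
      ((Equiv.addRight (1 : Fin (N + 2))).trans σ).prod_comp fun i => minSum x i ^ k
    calc (1 / 4) ^ k * (∏ i, minSum x i ^ k) * (1 + k * Real.log 4 * (1 - R σ))
        ≤ (1 / 4) ^ k * (∏ i, minSum x i ^ k) * Real.exp (k * Real.log 4 * (1 - R σ)) := by
          refine mul_le_mul_of_nonneg_left ?_ (by positivity)
          linarith [Real.add_one_le_exp (k * Real.log 4 * (1 - R σ))]
      _ = ∏ i, (minSum x (σ (i + 1)) * Real.exp (-(r (σ (i + 1)) (σ i) * Real.log 4))) ^ k := by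
          simp only [mul_pow, Finset.prod_mul_distrib, hshift]
          rw [← hquarter, Finset.prod_pow _ k fun i =>
            Real.exp (-(r (σ (i + 1)) (σ i) * Real.log 4)), ← Real.exp_sum, ← Real.exp_nat_mul, ← Real.exp_nat_mul,
            mul_comm (Real.exp _), mul_assoc, ← Real.exp_add]
          congr 2
          rw [Finset.sum_neg_distrib, ← Finset.sum_mul]
          simp only [R]; ring
      _ ≤ _ := by
          refine Finset.prod_le_prod (fun i _ => pow_nonneg (mul_nonneg (hT _).le
            (Real.exp_nonneg _)) k) fun i _ => pow_le_pow_left₀ (mul_nonneg (hT _).le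
            (Real.exp_nonneg _)) ?_ k
          have hne : σ (i + 1) ≠ σ i := fun h => by simpa using σ.injective h
          rw [minSum_comp_perm]
          refine (mul_le_mul_of_nonneg_left
            (exp_neg_mul_log_four_le (hr0 _ _) (hr1 _ _ hne)) (hT _).le).trans_eq ?_
          simp only [r, Function.comp_apply]
          field_simp [(hT (σ (i + 1))).ne']
  refine le_trans ?_ (Finset.sum_le_sum fun σ _ => hterm σ)
  rw [← Finset.mul_sum, Finset.sum_add_distrib, ← Finset.mul_sum, Finset.sum_sub_distrib]
  simp only [Finset.sum_const, Finset.card_univ, Fintype.card_perm, Fintype.card_fin,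
    nsmul_eq_mul, mul_one]
  rw [mul_comm]
  refine mul_le_mul_of_nonneg_left ?_ (by positivity)
  have : 0 ≤ k * Real.log 4 * ((N + 2).factorial - ∑ σ, R σ) :=
    mul_nonneg (by positivity) (sub_nonneg.2 hR)
  linarith

/-- Integrated form of `factorial_mul_prod_minSum_le`. -/
theorem setLIntegral_prod_minSum_le (N k : ℕ) :
    (1 / 4) ^ k * ∫⁻ x in openSimplex (N + 2), ∏ i, ENNReal.ofReal (minSum x i) ^ k ≤
      ∫⁻ x in openSimplex (N + 2),
        ∏ i, ENNReal.ofReal (minSum x (i + 1) - min (x (i + 1)) (x i)) ^ k := by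
  set n := N + 2 with hn
  let g : (Fin n → ℝ) → ℝ≥0∞ := fun x =>
    ∏ i, ENNReal.ofReal (minSum x (i + 1) - min (x (i + 1)) (x i)) ^ k
  have hmin := @measurable_minSum n
  have hg : Measurable g := by fun_prop
  have hf : Measurable fun x : Fin n → ℝ => ∏ i, ENNReal.ofReal (minSum x i) ^ k := by fun_prop
  have hfact : (n.factorial : ℝ≥0∞) ≠ 0 := by exact_mod_cast n.factorial_ne_zero
  refine (ENNReal.mul_le_mul_iff_right hfact (ENNReal.natCast_ne_top _)).1 ?_
  have h1 : (n.factorial : ℝ≥0∞) * ∫⁻ x in openSimplex n, g x =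
      ∫⁻ x in openSimplex n, ∑ σ : Equiv.Perm (Fin n), g (x ∘ σ) := by
    rw [lintegral_finsetSum Finset.univ (f := fun (σ : Equiv.Perm (Fin n)) x => g (x ∘ σ))
      fun σ _ => hg.comp (measurePreserving_comp_perm σ).measurable]
    have : ∀ σ : Equiv.Perm (Fin n), ∫⁻ x in openSimplex n, g (x ∘ σ) =
        ∫⁻ x in openSimplex n, g x := by
      intro σ
      rw [← (measurePreserving_comp_perm σ).setLIntegral_comp_preimage
        (measurableSet_openSimplex n) hg]
      congr 2
      ext x; exact (comp_perm_mem_openSimplex σ x).symm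
    simp [this, Fintype.card_perm]
  change _ ≤ _ * ∫⁻ x in openSimplex n, g x
  rw [h1, ← mul_assoc, ← lintegral_const_mul _ hf]
  refine setLIntegral_mono' (measurableSet_openSimplex n) fun x hx => ?_
  have h := factorial_mul_prod_minSum_le k hx.1
  have hT := minSum_pos hx.1
  have h2 := ENNReal.ofReal_le_ofReal h
  have hnn : ∀ (σ : Equiv.Perm (Fin n)) (i : Fin n),
      0 ≤ minSum (x ∘ σ) (i + 1) - min ((x ∘ σ) (i + 1)) ((x ∘ σ) i) := by
    intro σ i
    rw [minSum_comp_perm]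
    exact sub_nonneg.2 ((min_le_left _ _).trans (le_minSum hx.1 _))
  rw [ENNReal.ofReal_sum_of_nonneg fun σ _ => Finset.prod_nonneg fun i _ => pow_nonneg (hnn σ i) k,
    ENNReal.ofReal_mul (by positivity), ENNReal.ofReal_natCast, ENNReal.ofReal_mul (by positivity),
    ENNReal.ofReal_prod_of_nonneg fun i _ => pow_nonneg (hT i).le k,
    ENNReal.ofReal_pow (by positivity), ← mul_assoc] at h2
  have h4 : ENNReal.ofReal (1 / 4) = 1 / 4 := by
    rw [ENNReal.ofReal_div_of_pos (by norm_num)]; norm_num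
  rw [h4] at h2
  calc _ = _ := ?_
    _ ≤ _ := h2
    _ = _ := ?_
  · congr 1
    exact Finset.prod_congr rfl fun i _ => (ENNReal.ofReal_pow (hT i).le k).symm
  · refine Finset.sum_congr rfl fun σ _ => ?_
    rw [ENNReal.ofReal_prod_of_nonneg fun i _ => pow_nonneg (hnn σ i) k]
    exact Finset.prod_congr rfl fun i _ => ENNReal.ofReal_pow (hnn σ i) k

/-! ### Clockwise distance, owned arcs and non-improving moves. -/

theorem clockwiseDist_coe {a b : ℝ} (h0 : 0 < b - a) (h1 : b - a ≤ 1) :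
    clockwiseDist (a : UnitAddCircle) (b : UnitAddCircle) = b - a := by
  unfold clockwiseDist
  rw [← AddCircle.coe_sub, AddCircle.equivIoc_coe_eq (a := (0 : ℝ)) (p := 1) ⟨h0, by simpa using h1⟩]

theorem clockwiseDist_coe_add_one {a b : ℝ} (h0 : -1 < b - a) (h1 : b - a ≤ 0) :
    clockwiseDist (a : UnitAddCircle) (b : UnitAddCircle) = b - a + 1 := by
  have h : ((b + 1 : ℝ) : UnitAddCircle) = b := AddCircle.coe_add_period 1 b
  rw [← h, clockwiseDist_coe (by linarith) (by linarith)]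
  ring

theorem clockwiseDist_self (a : UnitAddCircle) : clockwiseDist a a = 1 := by
  obtain ⟨a, rfl⟩ := QuotientAddGroup.mk_surjective a
  have := clockwiseDist_coe_add_one (a := a) (b := a) (by simp) (by simp)
  simpa using this

theorem clockwiseDist_add_right (a b c : UnitAddCircle) :
    clockwiseDist (a + c) (b + c) = clockwiseDist a b := by
  unfold clockwiseDist; rw [add_sub_add_right_eq_sub]

theorem measurable_clockwiseDist :
    Measurable fun q : UnitAddCircle × UnitAddCircle => clockwiseDist q.1 q.2 :=
  measurable_subtype_coe.comp ((AddCircle.measurableEquivIoc (1 : ℝ) 0).measurable.comp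
    (measurable_snd.sub measurable_fst))

theorem ownedArc_le {n : ℕ} (c : Fin n → UnitAddCircle) (i j : Fin n) :
    ownedArc c i ≤ clockwiseDist (c i) (c j) :=
  Finset.inf'_le (fun j => clockwiseDist (c i) (c j)) (Finset.mem_univ j)

theorem exists_clockwiseDist_eq_ownedArc {n : ℕ} (c : Fin n → UnitAddCircle) (i : Fin n) :
    ∃ j, ownedArc c i = clockwiseDist (c i) (c j) := by
  obtain ⟨j, -, hj⟩ := Finset.exists_mem_eq_inf' ⟨i, Finset.mem_univ i⟩
    fun j => clockwiseDist (c i) (c j)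
  exact ⟨j, hj⟩

theorem le_ownedArc_iff {n : ℕ} (c : Fin n → UnitAddCircle) (i : Fin n) (a : ℝ) :
    a ≤ ownedArc c i ↔ ∀ j, a ≤ clockwiseDist (c i) (c j) := by
  refine ⟨fun h j => h.trans (ownedArc_le c i j), fun h => ?_⟩
  obtain ⟨j, hj⟩ := exists_clockwiseDist_eq_ownedArc c i
  exact hj ▸ h j

theorem measurable_ownedArc {n : ℕ} (i : Fin n) :
    Measurable fun c : Fin n → UnitAddCircle => ownedArc c i := by
  refine measurable_of_Ici fun a => ?_
  have : (fun c : Fin n → UnitAddCircle => ownedArc c i) ⁻¹' Set.Ici a =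
      ⋂ j, {c | a ≤ clockwiseDist (c i) (c j)} := by
    ext c; simp [le_ownedArc_iff]
  rw [this]
  refine MeasurableSet.iInter fun j => measurableSet_le measurable_const ?_
  exact measurable_clockwiseDist.comp (f := fun c : Fin n → UnitAddCircle => (c i, c j))
    ((measurable_pi_apply i).prodMk (measurable_pi_apply j))

/-- The points to which player `i` can move without an increase of utility. -/
def nonImprovingSet {n : ℕ} (c : Fin n → UnitAddCircle) (i : Fin n) : Set UnitAddCircle :=
  {y | ownedArc (Function.update c i y) i ≤ ownedArc c i}

theorem measurableSet_nonImproving {n : ℕ} (i : Fin n) :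
    MeasurableSet {q : (Fin n → UnitAddCircle) × UnitAddCircle | q.2 ∈ nonImprovingSet q.1 i} := by
  refine measurableSet_le ?_ ((measurable_ownedArc i).comp measurable_fst)
  refine (measurable_ownedArc i).comp (measurable_pi_lambda _ fun j => ?_)
  by_cases h : j = i
  · subst h; simpa using measurable_snd
  · simp only [Function.update_of_ne h]
    exact (measurable_pi_apply j).comp measurable_fst

theorem measurableSet_nonImprovingSet {n : ℕ} (c : Fin n → UnitAddCircle) (i : Fin n) :
    MeasurableSet (nonImprovingSet c i) :=
  measurable_prodMk_left (x := c) (measurableSet_nonImproving i)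

/-! ### The circle cut into arcs, and the measure of the non-improving set. -/

/-- The left end point of the `j`-th of the consecutive intervals with lengths `x`. -/
def leftEnd {n : ℕ} (x : Fin n → ℝ) (j : Fin n) : ℝ := ∑ l ∈ Finset.Iio j, x l

/-- The right end point of the `j`-th of the consecutive intervals with lengths `x`. -/
def rightEnd {n : ℕ} (x : Fin n → ℝ) (j : Fin n) : ℝ := ∑ l ∈ Finset.Iic j, x l

theorem rightEnd_eq {n : ℕ} (x : Fin n → ℝ) (j : Fin n) : rightEnd x j = leftEnd x j + x j := by
  have : Finset.Iic j = insert j (Finset.Iio j) := by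
    ext l; simp [le_iff_eq_or_lt]
  rw [rightEnd, this, Finset.sum_insert (by simp), add_comm, leftEnd]

theorem rightEnd_le_leftEnd {n : ℕ} {x : Fin n → ℝ} (hx : ∀ i, 0 < x i) {j l : Fin n}
    (h : j < l) : rightEnd x j ≤ leftEnd x l :=
  Finset.sum_le_sum_of_subset_of_nonneg (fun a ha => by
    simp only [Finset.mem_Iic, Finset.mem_Iio] at *; exact ha.trans_lt h) fun i _ _ => (hx i).le

theorem leftEnd_nonneg {n : ℕ} {x : Fin n → ℝ} (hx : ∀ i, 0 < x i) (j : Fin n) :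
    0 ≤ leftEnd x j := Finset.sum_nonneg fun i _ => (hx i).le

theorem rightEnd_le_sum {n : ℕ} {x : Fin n → ℝ} (hx : ∀ i, 0 < x i) (j : Fin n) :
    rightEnd x j ≤ ∑ i, x i :=
  Finset.sum_le_sum_of_subset_of_nonneg (Finset.subset_univ _) fun i _ _ => (hx i).le

theorem leftEnd_succ {N : ℕ} (x : Fin (N + 1) → ℝ) (i : Fin N) :
    leftEnd x i.succ = rightEnd x i.castSucc := by
  rw [rightEnd_eq]; exact Fin.sum_Iio_succ x i

theorem leftEnd_zero {N : ℕ} (x : Fin (N + 1) → ℝ) : leftEnd x 0 = 0 := by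
  rw [leftEnd, show Finset.Iio (0 : Fin (N + 1)) = ∅ by ext; simp, Finset.sum_empty]

theorem rightEnd_last {N : ℕ} (x : Fin (N + 1) → ℝ) : rightEnd x (Fin.last N) = ∑ i, x i := by
  rw [rightEnd, show Finset.Iic (Fin.last N) = Finset.univ by ext i; simp [Fin.le_last]]

theorem exists_mem_Ico_leftEnd_rightEnd {N : ℕ} {x : Fin (N + 1) → ℝ} {y : ℝ} (h0 : 0 ≤ y)
    (h1 : y < ∑ i, x i) : ∃ j, y ∈ Set.Ico (leftEnd x j) (rightEnd x j) := by
  by_contra! h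
  have : ∀ j, leftEnd x j ≤ y := by
    intro j
    induction j using Fin.induction with
    | zero => rwa [leftEnd_zero]
    | succ i ih =>
      rw [leftEnd_succ]
      by_contra! h2
      exact h _ ⟨ih, h2⟩
  exact h (Fin.last N) ⟨this _, by rwa [rightEnd_last]⟩

/-- Addition in `Fin` wraps around, and so does the circle: the last right end is 1, which is the
point 0. -/
theorem coe_rightEnd {N : ℕ} {x : Fin (N + 1) → ℝ} (hx : ∑ i, x i = 1) (i : Fin (N + 1)) :
    (rightEnd x i : UnitAddCircle) = (leftEnd x (i + 1) : ℝ) := by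
  induction i using Fin.lastCases with
  | last =>
    rw [Fin.last_add_one, leftEnd_zero, rightEnd_last, hx]
    exact AddCircle.coe_period 1
  | cast i => rw [Fin.coeSucc_eq_succ, leftEnd_succ]

/-- No right end is met clockwise from y before that of its own arc; the right ends of earlier arcs
are reached only after passing 0. -/
theorem sub_le_clockwiseDist {N : ℕ} {x : Fin (N + 1) → ℝ} (hx : ∀ i, 0 < x i)
    (hx1 : ∑ i, x i = 1) {y : ℝ} {l : Fin (N + 1)}
    (hy : y ∈ Set.Ico (leftEnd x l) (rightEnd x l)) (j : Fin (N + 1)) :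
    rightEnd x l - y ≤ clockwiseDist (y : UnitAddCircle) (rightEnd x j : ℝ) := by
  have h0 := leftEnd_nonneg hx l
  have h1 := rightEnd_le_sum hx l
  have h2 := rightEnd_le_sum hx j
  have h3 := leftEnd_nonneg hx j
  have h4 := rightEnd_eq x j
  have h5 := hx j
  obtain ⟨h6, h7⟩ := hy
  rcases lt_or_ge j l with h | h
  · have h8 := rightEnd_le_leftEnd hx h
    rw [clockwiseDist_coe_add_one (by linarith) (by linarith)]
    linarith
  · have h8 : rightEnd x l ≤ rightEnd x j := by
      rcases h.eq_or_lt with h | h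
      · rw [h]
      · linarith [rightEnd_le_leftEnd hx h]
    rw [clockwiseDist_coe (by linarith) (by linarith)]
    linarith

theorem clockwiseDist_rightEnd {N : ℕ} {x : Fin (N + 1) → ℝ} (hx : ∀ i, 0 < x i)
    (hx1 : ∑ i, x i = 1) {y : ℝ} {l : Fin (N + 1)}
    (hy : y ∈ Set.Ico (leftEnd x l) (rightEnd x l)) :
    clockwiseDist (y : UnitAddCircle) (rightEnd x l : ℝ) = rightEnd x l - y := by
  have h0 := leftEnd_nonneg hx l
  have h1 := rightEnd_le_sum hx l
  exact clockwiseDist_coe (by linarith [hy.2]) (by linarith [hy.1])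

/-- Player i sits at the end of arc i, hence owns arc i + 1. This shift explains the indices i + 1
and i below. -/
theorem ownedArc_rightEnd {N : ℕ} {x : Fin (N + 1) → ℝ} (hx : ∀ i, 0 < x i)
    (hx1 : ∑ i, x i = 1) (i : Fin (N + 1)) :
    ownedArc (fun j => (rightEnd x j : UnitAddCircle)) i = x (i + 1) := by
  have hmem : leftEnd x (i + 1) ∈ Set.Ico (leftEnd x (i + 1)) (rightEnd x (i + 1)) :=
    ⟨le_rfl, by rw [rightEnd_eq]; linarith [hx (i + 1)]⟩
  have hlen : rightEnd x (i + 1) - leftEnd x (i + 1) = x (i + 1) := by rw [rightEnd_eq]; ring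
  refine le_antisymm ?_ ((le_ownedArc_iff _ _ _).2 fun j => ?_)
  · refine (ownedArc_le _ i (i + 1)).trans_eq ?_
    rw [coe_rightEnd hx1 i, clockwiseDist_rightEnd hx hx1 hmem, hlen]
  · rw [coe_rightEnd hx1 i]
    exact hlen.symm.le.trans (sub_le_clockwiseDist hx hx1 hmem j)

theorem volume_eq_volume_preimage_Ioo {A : Set UnitAddCircle} (hA : MeasurableSet A) :
    volume A = volume ((fun y : ℝ => (y : UnitAddCircle)) ⁻¹' A ∩ Set.Ioo 0 1) := by
  have h := AddCircle.add_projection_respects_measure (1 : ℝ) 0 hA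
  rw [h]
  refine measure_congr ((Filter.EventuallyEq.refl _ _).inter ?_)
  rw [zero_add]
  exact Ioo_ae_eq_Ioc.symm

/-- A move to a point y of arc l owns at least the rest of that arc, even for l = i, where the
player's own departure only lengthens the way. So y must be within x (i + 1) of the end of arc l. -/
theorem volume_nonImprovingSet_le {N : ℕ} {x : Fin (N + 1) → ℝ} (hx : ∀ i, 0 < x i)
    (hx1 : ∑ i, x i = 1) (i : Fin (N + 1)) :
    volume (nonImprovingSet (fun j => (rightEnd x j : UnitAddCircle)) i) ≤
      ENNReal.ofReal (minSum x (i + 1)) := by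
  rw [volume_eq_volume_preimage_Ioo (measurableSet_nonImprovingSet _ _)]
  have hsub : (fun y : ℝ => (y : UnitAddCircle)) ⁻¹'
      nonImprovingSet (fun j => (rightEnd x j : UnitAddCircle)) i ∩ Set.Ioo 0 1 ⊆
      ⋃ l, Set.Ico (rightEnd x l - min (x (i + 1)) (x l)) (rightEnd x l) := by
    rintro y ⟨hy, hy0, hy1⟩
    obtain ⟨l, hl⟩ := exists_mem_Ico_leftEnd_rightEnd hy0.le (by rwa [hx1])
    refine Set.mem_iUnion.2 ⟨l, ?_, hl.2⟩
    have hlx : rightEnd x l - y ≤ x l := by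
      have := rightEnd_eq x l
      linarith [hl.1]
    suffices rightEnd x l - y ≤ x (i + 1) by linarith [le_min this hlx]
    have hy' : ownedArc (Function.update (fun j => (rightEnd x j : UnitAddCircle)) i y) i ≤
        ownedArc (fun j => (rightEnd x j : UnitAddCircle)) i := hy
    rw [ownedArc_rightEnd hx hx1] at hy'
    obtain ⟨j, hj⟩ := exists_clockwiseDist_eq_ownedArc
      (Function.update (fun j => (rightEnd x j : UnitAddCircle)) i y) i
    rw [hj, Function.update_self] at hy'
    refine le_trans ?_ hy'
    by_cases hji : j = i
    · rw [hji, Function.update_self, clockwiseDist_self]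
      linarith [rightEnd_le_sum hx l]
    · rw [Function.update_of_ne hji]
      exact sub_le_clockwiseDist hx hx1 hl j
  refine (measure_mono hsub).trans ((measure_iUnion_fintype_le _ _).trans_eq ?_)
  simp only [Real.volume_Ico, sub_sub_cancel]
  rw [← ENNReal.ofReal_sum_of_nonneg fun l _ => (lt_min (hx _) (hx l)).le, minSum]

/-- For l ≠ i the end of arc l is still occupied after the move, so landing close enough to it does
not help. Only arc i is dropped, hence the subtracted term. -/
theorem le_volume_nonImprovingSet {N : ℕ} {x : Fin (N + 1) → ℝ} (hx : ∀ i, 0 < x i)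
    (hx1 : ∑ i, x i = 1) (i : Fin (N + 1)) :
    ENNReal.ofReal (minSum x (i + 1) - min (x (i + 1)) (x i)) ≤
      volume (nonImprovingSet (fun j => (rightEnd x j : UnitAddCircle)) i) := by
  rw [volume_eq_volume_preimage_Ioo (measurableSet_nonImprovingSet _ _)]
  let I : Fin (N + 1) → Set ℝ := fun l =>
    Set.Ioo (rightEnd x l - min (x (i + 1)) (x l)) (rightEnd x l)
  have hI : ∀ l, ∀ y ∈ I l, y ∈ Set.Ico (leftEnd x l) (rightEnd x l) := fun l y hy =>
    ⟨by linarith [hy.1, rightEnd_eq x l, min_le_right (x (i + 1)) (x l)], hy.2⟩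
  have hsub : (⋃ l ∈ Finset.univ.erase i, I l) ⊆ (fun y : ℝ => (y : UnitAddCircle)) ⁻¹'
      nonImprovingSet (fun j => (rightEnd x j : UnitAddCircle)) i ∩ Set.Ioo 0 1 := by
    refine Set.iUnion₂_subset fun l hl y hy => ⟨?_, ?_, ?_⟩
    · change ownedArc (Function.update (fun j => (rightEnd x j : UnitAddCircle)) i y) i ≤
        ownedArc (fun j => (rightEnd x j : UnitAddCircle)) i
      rw [ownedArc_rightEnd hx hx1]
      refine (ownedArc_le _ i l).trans ?_
      rw [Function.update_self, Function.update_of_ne (Finset.ne_of_mem_erase hl),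
        clockwiseDist_rightEnd hx hx1 (hI l y hy)]
      linarith [hy.1, min_le_left (x (i + 1)) (x l)]
    · have := leftEnd_nonneg hx l
      linarith [hy.1, rightEnd_eq x l, min_le_right (x (i + 1)) (x l)]
    · exact hy.2.trans_le ((rightEnd_le_sum hx l).trans_eq hx1)
  refine le_trans ?_ (measure_mono hsub)
  rw [measure_biUnion_finset]
  · simp only [I, Real.volume_Ioo, sub_sub_cancel]
    rw [← ENNReal.ofReal_sum_of_nonneg fun l _ => (lt_min (hx _) (hx l)).le,
      Finset.sum_erase_eq_sub (Finset.mem_univ i), minSum]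
  · intro j _ l _ hjl
    refine Set.disjoint_left.2 fun y hy hy' => ?_
    have h1 := hI j y hy
    have h2 := hI l y hy'
    rcases lt_or_gt_of_ne hjl with h | h
    · linarith [rightEnd_le_leftEnd hx h, h1.2, h2.1]
    · linarith [rightEnd_le_leftEnd hx h, h1.1, h2.2]
  · exact fun _ _ => measurableSet_Ioo

/-! ### From uniform points on the circle to arc lengths on the simplex. -/

/-- The increasing tuples of reals in the open interval `(0, r)`. -/
def orderedTuples (n : ℕ) (r : ℝ) : Set (Fin n → ℝ) :=
  {t | StrictMono t ∧ ∀ i, t i ∈ Set.Ioo 0 r}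

theorem orderedTuples_eq (n : ℕ) (r : ℝ) :
    orderedTuples n r = {t | StrictMono t} ∩ Set.univ.pi fun _ => Set.Ioo 0 r := by
  ext t; simp [orderedTuples]

theorem measurableSet_orderedTuples (n : ℕ) (r : ℝ) : MeasurableSet (orderedTuples n r) := by
  rw [orderedTuples_eq]
  exact (measurableSet_strictMono n).inter
    (MeasurableSet.univ_pi fun _ => measurableSet_Ioo)

/-- A rotation invariant function of uniform points on the circle: the last point may be fixed. -/
theorem lintegral_circle_eq_lintegral_snoc_zero {N : ℕ} {F : (Fin (N + 1) → UnitAddCircle) → ℝ≥0∞}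
    (hF : Measurable F) (hrot : ∀ c a, F (fun i => c i + a) = F c) :
    ∫⁻ c, F c = ∫⁻ c : Fin N → UnitAddCircle, F (Fin.snoc c 0) := by
  have h := (volume_preserving_piFinSuccAbove (fun _ : Fin (N + 1) => UnitAddCircle)
    (Fin.last N)).symm
  have hm : Measurable fun p : UnitAddCircle × (Fin N → UnitAddCircle) =>
      F ((MeasurableEquiv.piFinSuccAbove (fun _ : Fin (N + 1) => UnitAddCircle)
        (Fin.last N)).symm p) := hF.comp h.measurable
  rw [← h.lintegral_comp hF, Measure.volume_eq_prod, lintegral_prod _ hm.aemeasurable]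
  have hval : ∀ (a : UnitAddCircle) (c : Fin N → UnitAddCircle),
      F ((MeasurableEquiv.piFinSuccAbove (fun _ : Fin (N + 1) => UnitAddCircle)
        (Fin.last N)).symm (a, c)) = F (Fin.snoc (c - fun _ => a) 0) := by
    intro a c
    rw [← hrot (Fin.snoc (c - fun _ => a) 0) a]
    congr 1
    funext i
    induction i using Fin.lastCases with
    | last => simp [MeasurableEquiv.piFinSuccAbove_symm_apply]
    | cast i => simp [MeasurableEquiv.piFinSuccAbove_symm_apply]
  simp only [hval]
  have hshift : ∀ a : UnitAddCircle,
      ∫⁻ c : Fin N → UnitAddCircle, F (Fin.snoc (c - fun _ => a) 0) =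
        ∫⁻ c : Fin N → UnitAddCircle, F (Fin.snoc c 0) := fun a =>
    lintegral_sub_right_eq_self (fun c : Fin N → UnitAddCircle => F (Fin.snoc c 0)) fun _ => a
  simp [hshift]

theorem measurable_comp_snoc_zero {N : ℕ} {F : (Fin (N + 1) → UnitAddCircle) → ℝ≥0∞}
    (hF : Measurable F) : Measurable fun c : Fin N → UnitAddCircle => F (Fin.snoc c 0) := by
  refine hF.comp (measurable_pi_lambda _ fun i => ?_)
  induction i using Fin.lastCases with
  | last => simp
  | cast i => simpa using measurable_pi_apply i

theorem lintegral_circle_eq_setLIntegral {N : ℕ} {H : (Fin N → UnitAddCircle) → ℝ≥0∞}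
    (hH : Measurable H) :
    ∫⁻ c, H c = ∫⁻ t in Set.univ.pi fun _ : Fin N => Set.Ioo (0 : ℝ) 1,
      H fun i => (t i : UnitAddCircle) := by
  have h0 : MeasurePreserving (fun t : ℝ => (t : UnitAddCircle))
      (volume.restrict (Set.Ioo 0 1)) volume := by
    have := AddCircle.measurePreserving_mk (1 : ℝ) 0
    rwa [zero_add, ← Measure.restrict_congr_set Ioo_ae_eq_Ioc] at this
  have h1 := measurePreserving_pi (fun _ : Fin N => (volume : Measure ℝ).restrict (Set.Ioo 0 1))
    (fun _ : Fin N => (volume : Measure UnitAddCircle)) fun _ => h0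
  rw [volume_pi, ← h1.lintegral_comp hH, volume_pi, Measure.restrict_pi_pi]

/-- Fixing one point and sorting the others. -/
theorem lintegral_circle_eq_factorial_mul {N : ℕ} {F : (Fin (N + 1) → UnitAddCircle) → ℝ≥0∞}
    (hF : Measurable F) (hrot : ∀ c a, F (fun i => c i + a) = F c)
    (hperm : ∀ (σ : Equiv.Perm (Fin (N + 1))) c, F (c ∘ σ) = F c) :
    ∫⁻ c, F c = N.factorial * ∫⁻ t in orderedTuples N 1,
      F (Fin.snoc (fun i => (t i : UnitAddCircle)) 0) := by
  have hH := measurable_comp_snoc_zero hF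
  rw [lintegral_circle_eq_lintegral_snoc_zero hF hrot, lintegral_circle_eq_setLIntegral hH]
  have hS : MeasurableSet (Set.univ.pi fun _ : Fin N => Set.Ioo (0 : ℝ) 1) :=
    MeasurableSet.univ_pi fun _ => measurableSet_Ioo
  let f : (Fin N → ℝ) → ℝ≥0∞ := (Set.univ.pi fun _ : Fin N => Set.Ioo (0 : ℝ) 1).indicator
    fun t => F (Fin.snoc (fun i => (t i : UnitAddCircle)) 0)
  have hf : Measurable f := by
    refine Measurable.indicator ?_ hS
    exact hH.comp (measurable_pi_lambda _ fun i =>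
      AddCircle.measurable_mk'.comp (measurable_pi_apply i))
  rw [← lintegral_indicator hS]
  change ∫⁻ t, f t = _
  rw [lintegral_eq_factorial_mul_setLIntegral_strictMono hf, setLIntegral_indicator hS,
    orderedTuples_eq, Set.inter_comm]
  intro σ t
  have hmem : t ∘ σ ∈ (Set.univ.pi fun _ : Fin N => Set.Ioo (0 : ℝ) 1) ↔
      t ∈ (Set.univ.pi fun _ : Fin N => Set.Ioo (0 : ℝ) 1) := by
    simp only [Set.mem_univ_pi, Function.comp_apply]
    exact σ.forall_congr_left.trans (by simp)
  have hval : F (Fin.snoc (fun i => ((t ∘ σ) i : UnitAddCircle)) 0) =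
      F (Fin.snoc (fun i => (t i : UnitAddCircle)) 0) := by
    -- The extension of σ that fixes the last index, where the point 0 sits.
    let τ : Equiv.Perm (Fin (N + 1)) :=
      { toFun := Fin.lastCases (Fin.last N) fun i => (σ i).castSucc
        invFun := Fin.lastCases (Fin.last N) fun i => (σ.symm i).castSucc
        left_inv := fun i => by induction i using Fin.lastCases <;> simp
        right_inv := fun i => by induction i using Fin.lastCases <;> simp }
    rw [← hperm τ (Fin.snoc (fun i => (t i : UnitAddCircle)) 0)]
    congr 1
    funext i
    induction i using Fin.lastCases with
    | last => simp [τ]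
    | cast i => simp [τ]
  by_cases ht : t ∈ (Set.univ.pi fun _ : Fin N => Set.Ioo (0 : ℝ) 1)
  · exact (Set.indicator_of_mem (hmem.2 ht) _).trans
      (hval.trans (Set.indicator_of_mem ht
        fun t => F (Fin.snoc (fun i => (t i : UnitAddCircle)) 0)).symm)
  · exact (Set.indicator_of_notMem (mt hmem.1 ht) _).trans
      (Set.indicator_of_notMem ht _).symm

theorem lintegral_comp_smul {n : ℕ} {g : (Fin n → ℝ) → ℝ≥0∞} (hg : Measurable g) {r : ℝ}
    (hr : 0 < r) : ∫⁻ t, g (r⁻¹ • t) = ENNReal.ofReal r ^ n * ∫⁻ t, g t := by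
  have hm : Measurable fun t : Fin n → ℝ => r⁻¹ • t := by fun_prop
  have h := Measure.map_addHaar_smul (volume : Measure (Fin n → ℝ)) (inv_ne_zero hr.ne')
  have h2 := lintegral_map (μ := volume) hg hm
  rw [h, lintegral_smul_measure] at h2
  rw [← h2]
  have : |((r⁻¹) ^ Module.finrank ℝ (Fin n → ℝ))⁻¹| = r ^ n := by
    rw [Module.finrank_fin_fun, inv_pow, inv_inv, abs_of_pos (pow_pos hr n)]
  rw [this, ENNReal.ofReal_pow hr.le, smul_eq_mul]

theorem inv_smul_mem_orderedTuples {n : ℕ} {r : ℝ} (hr : 0 < r) (t : Fin n → ℝ) :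
    r⁻¹ • t ∈ orderedTuples n 1 ↔ t ∈ orderedTuples n r := by
  have h : ∀ a b : ℝ, r⁻¹ * a < r⁻¹ * b ↔ a < b := fun a b => mul_lt_mul_iff_right₀ (inv_pos.2 hr)
  have h1 : r⁻¹ * r = 1 := inv_mul_cancel₀ hr.ne'
  simp only [orderedTuples, Set.mem_ofPred_eq, Set.mem_Ioo, StrictMono, Pi.smul_apply, smul_eq_mul, h]
  refine and_congr_right fun _ => forall_congr' fun i => ?_
  have h2 := h 0 (t i)
  have h3 := h (t i) r
  rw [mul_zero] at h2
  rw [h1] at h3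
  rw [h2, h3]

theorem setLIntegral_orderedTuples_comp_smul {n : ℕ} {H : (Fin n → ℝ) → ℝ≥0∞} (hH : Measurable H)
    {r : ℝ} (hr : 0 < r) :
    ∫⁻ t in orderedTuples n r, H (r⁻¹ • t) =
      ENNReal.ofReal r ^ n * ∫⁻ t in orderedTuples n 1, H t := by
  rw [← lintegral_indicator (measurableSet_orderedTuples n 1),
    ← lintegral_comp_smul (hH.indicator (measurableSet_orderedTuples n 1)) hr,
    ← lintegral_indicator (measurableSet_orderedTuples n r)]
  refine lintegral_congr fun t => ?_
  by_cases ht : t ∈ orderedTuples n r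
  · rw [Set.indicator_of_mem ht, Set.indicator_of_mem ((inv_smul_mem_orderedTuples hr t).2 ht)]
  · rw [Set.indicator_of_notMem ht,
      Set.indicator_of_notMem (mt (inv_smul_mem_orderedTuples hr t).1 ht)]

theorem snoc_mem_orderedTuples {N : ℕ} (t : Fin N → ℝ) (r : ℝ) :
    (Fin.snoc t r : Fin (N + 1) → ℝ) ∈ orderedTuples (N + 1) 1 ↔
      r ∈ Set.Ioo (0 : ℝ) 1 ∧ t ∈ orderedTuples N r := by
  simp only [orderedTuples, Set.mem_ofPred_eq, Fin.forall_fin_succ', Fin.snoc_castSucc,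
    Fin.snoc_last, StrictMono, Set.mem_Ioo, Fin.castSucc_lt_castSucc_iff, Fin.castSucc_lt_last,
    lt_irrefl, forall_const]
  constructor
  · rintro ⟨h1, h2, h3, h4⟩
    refine ⟨⟨h3, h4⟩, fun a b hab => (h1.1 a).1 b hab, fun i => ⟨(h2 i).1, (h1.1 i).2⟩⟩
  · rintro ⟨⟨h3, h4⟩, h1, h2⟩
    refine ⟨⟨fun a => ⟨fun b hab => h1 hab, (h2 a).2⟩, fun a h => ?_, fun h => ?_⟩,
      fun i => ⟨(h2 i).1, (h2 i).2.trans h4⟩, h3, h4⟩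
    · exact absurd h (Fin.castSucc_lt_last a).not_gt
    · trivial

/-- Integrating out the largest entry of an increasing tuple. -/
theorem setLIntegral_orderedTuples_succ {N : ℕ} (K : ℕ) {H : (Fin N → ℝ) → ℝ≥0∞}
    (hH : Measurable H) :
    ∫⁻ s in orderedTuples (N + 1) 1, ENNReal.ofReal (s (Fin.last N)) ^ K *
      H (fun i => s i.castSucc / s (Fin.last N)) =
      ((N + K : ℕ) + 1 : ℝ≥0∞)⁻¹ * ∫⁻ t in orderedTuples N 1, H t := by
  let g : (Fin (N + 1) → ℝ) → ℝ≥0∞ := (orderedTuples (N + 1) 1).indicator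
    fun s => ENNReal.ofReal (s (Fin.last N)) ^ K * H (fun i => s i.castSucc / s (Fin.last N))
  have hg : Measurable g := by
    refine Measurable.indicator ?_ (measurableSet_orderedTuples _ _)
    refine Measurable.mul (by fun_prop) (hH.comp (measurable_pi_lambda _ fun i => by fun_prop))
  have h := (volume_preserving_piFinSuccAbove (fun _ : Fin (N + 1) => ℝ) (Fin.last N)).symm
  have hm : Measurable fun p : ℝ × (Fin N → ℝ) =>
      g ((MeasurableEquiv.piFinSuccAbove (fun _ : Fin (N + 1) => ℝ) (Fin.last N)).symm p) :=
    hg.comp h.measurable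
  rw [← lintegral_indicator (measurableSet_orderedTuples _ _)]
  change ∫⁻ s, g s = _
  rw [← h.lintegral_comp hg, Measure.volume_eq_prod, lintegral_prod _ hm.aemeasurable]
  have hinner : ∀ r : ℝ, ∫⁻ t : Fin N → ℝ,
      g ((MeasurableEquiv.piFinSuccAbove (fun _ : Fin (N + 1) => ℝ) (Fin.last N)).symm (r, t)) =
      (Set.Ioo (0 : ℝ) 1).indicator (fun r => ENNReal.ofReal r ^ (N + K) *
        ∫⁻ t in orderedTuples N 1, H t) r := by
    intro r
    have hs : ∀ t : Fin N → ℝ, (MeasurableEquiv.piFinSuccAbove (fun _ : Fin (N + 1) => ℝ)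
        (Fin.last N)).symm (r, t) = (Fin.snoc t r : Fin (N + 1) → ℝ) := fun t => by
      rw [MeasurableEquiv.piFinSuccAbove_symm_apply, Fin.insertNthEquiv_last]
      rfl
    simp only [hs]
    by_cases hr : r ∈ Set.Ioo (0 : ℝ) 1
    -- The factor r ^ N is the Jacobian of scaling the remaining N entries by the largest one; r ^ K
    -- is the given weight.
    · rw [Set.indicator_of_mem hr, pow_add, mul_comm (ENNReal.ofReal r ^ N), mul_assoc,
        ← setLIntegral_orderedTuples_comp_smul hH hr.1,
        ← lintegral_indicator (measurableSet_orderedTuples N r),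
        ← lintegral_const_mul]
      · refine lintegral_congr fun t => ?_
        by_cases ht : t ∈ orderedTuples N r
        · rw [Set.indicator_of_mem ht]
          refine (Set.indicator_of_mem ((snoc_mem_orderedTuples t r).2 ⟨hr, ht⟩) _).trans ?_
          simp only [Fin.snoc_last, Fin.snoc_castSucc]
          congr 2
          funext i
          simp [div_eq_inv_mul]
        · rw [Set.indicator_of_notMem ht, mul_zero]
          exact Set.indicator_of_notMem (fun h => ht ((snoc_mem_orderedTuples t r).1 h).2) _
      · exact (hH.comp (by fun_prop)).indicator (measurableSet_orderedTuples N r)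
    · rw [Set.indicator_of_notMem hr]
      have : ∀ t : Fin N → ℝ, g (Fin.snoc t r) = 0 := fun t =>
        Set.indicator_of_notMem (fun h => hr ((snoc_mem_orderedTuples t r).1 h).1) _
      simp [this]
  refine (lintegral_congr hinner).trans ?_
  rw [lintegral_indicator measurableSet_Ioo, lintegral_mul_const _ (by fun_prop),
    setLIntegral_Ioo_ofReal_pow]

/-- The matrix of the partial sums `rightEnd`. -/
def rightEndMatrix (n : ℕ) : Matrix (Fin n) (Fin n) ℝ := fun i j => if j ≤ i then 1 else 0

theorem det_rightEndMatrix (n : ℕ) : (rightEndMatrix n).det = 1 := by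
  rw [Matrix.det_of_isLowerTriangular]
  · simp [rightEndMatrix]
  · intro i j hij
    have : i < j := hij
    simp [rightEndMatrix, this.not_ge]

theorem rightEndMatrix_mulVec {n : ℕ} (x : Fin n → ℝ) :
    (rightEndMatrix n).mulVec x = rightEnd x := by
  funext i
  simp only [Matrix.mulVec, dotProduct, rightEndMatrix, ite_mul, one_mul, zero_mul, rightEnd]
  rw [← Finset.sum_filter]
  congr 1
  ext; simp

theorem rightEnd_mem_orderedTuples {N : ℕ} (x : Fin (N + 1) → ℝ) :
    rightEnd x ∈ orderedTuples (N + 1) 1 ↔ x ∈ openSimplex (N + 1) := by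
  have hsm : StrictMono (rightEnd x) ↔ ∀ i : Fin N, 0 < x i.succ := by
    rw [Fin.strictMono_iff_lt_succ]
    refine forall_congr' fun i => ?_
    rw [rightEnd_eq x i.succ, leftEnd_succ]
    simp
  simp only [orderedTuples, openSimplex, Set.mem_ofPred_eq, Set.mem_Ioo, forall_and]
  have h0 : rightEnd x 0 = x 0 := by rw [rightEnd_eq, leftEnd_zero, zero_add]
  constructor
  · rintro ⟨h1, h2, h3⟩
    refine ⟨Fin.cases (by rw [← h0]; exact h2 0) (hsm.1 h1), ?_⟩
    rw [← rightEnd_last]; exact h3 _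
  · rintro ⟨h1, h2⟩
    have h3 := hsm.2 fun i => h1 _
    refine ⟨h3, h3.forall_pos_iff.2 (by rw [h0]; exact h1 0), (h3.forall_lt_iff 1).2 ?_⟩
    rwa [rightEnd_last]

/-- Partial sums are a linear map of determinant 1 that matches positive lengths with increasing end
points. -/
theorem setLIntegral_orderedTuples_eq {N : ℕ} {G : (Fin (N + 1) → ℝ) → ℝ≥0∞} (hG : Measurable G) :
    ∫⁻ s in orderedTuples (N + 1) 1, G s = ∫⁻ x in openSimplex (N + 1), G (rightEnd x) := by
  have h := lintegral_mulVec (rightEndMatrix (N + 1)) (by rw [det_rightEndMatrix]; exact one_ne_zero)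
    (hG.indicator (measurableSet_orderedTuples (N + 1) 1))
  rw [det_rightEndMatrix, abs_one, inv_one, ENNReal.ofReal_one, one_mul] at h
  rw [← lintegral_indicator (measurableSet_orderedTuples _ _), ← h,
    ← lintegral_indicator (measurableSet_openSimplex _)]
  refine lintegral_congr fun x => ?_
  rw [rightEndMatrix_mulVec]
  by_cases hx : x ∈ openSimplex (N + 1)
  · rw [Set.indicator_of_mem hx, Set.indicator_of_mem ((rightEnd_mem_orderedTuples x).2 hx)]
  · rw [Set.indicator_of_notMem hx,
      Set.indicator_of_notMem (mt (rightEnd_mem_orderedTuples x).1 hx)]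

theorem rightEnd_div {n : ℕ} (x : Fin n → ℝ) (r : ℝ) (i : Fin n) :
    rightEnd (fun j => x j / r) i = rightEnd x i / r := by
  rw [rightEnd, rightEnd, Finset.sum_div]

/-- The mean of a symmetric and rotation invariant function of uniform points on the circle, as an
integral over the lengths of the arcs on circles of circumference less than `1`. -/
theorem lintegral_circle_eq_setLIntegral_openSimplex {N : ℕ} (K : ℕ)
    {F : (Fin (N + 1) → UnitAddCircle) → ℝ≥0∞}
    (hF : Measurable F) (hrot : ∀ c a, F (fun i => c i + a) = F c)
    (hperm : ∀ (σ : Equiv.Perm (Fin (N + 1))) c, F (c ∘ σ) = F c) :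
    ∫⁻ c, F c = N.factorial * (((N + K : ℕ) + 1) * ∫⁻ x in openSimplex (N + 1),
      ENNReal.ofReal (∑ i, x i) ^ K *
        F fun i => (rightEnd (fun j => x j / ∑ l, x l) i : UnitAddCircle)) := by
  let H : (Fin N → ℝ) → ℝ≥0∞ := fun t => F (Fin.snoc (fun i => (t i : UnitAddCircle)) 0)
  have hH : Measurable H := (measurable_comp_snoc_zero hF).comp (measurable_pi_lambda _ fun i =>
      AddCircle.measurable_mk'.comp (measurable_pi_apply i))
  rw [lintegral_circle_eq_factorial_mul hF hrot hperm]
  congr 1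
  have h := setLIntegral_orderedTuples_succ K hH
  rw [setLIntegral_orderedTuples_eq] at h
  · have h2 : ∫⁻ x in openSimplex (N + 1), ENNReal.ofReal (∑ i, x i) ^ K *
        F (fun i => (rightEnd (fun j => x j / ∑ l, x l) i : UnitAddCircle)) =
        ∫⁻ x in openSimplex (N + 1), ENNReal.ofReal (rightEnd x (Fin.last N)) ^ K *
          H (fun i => rightEnd x i.castSucc / rightEnd x (Fin.last N)) := by
      refine setLIntegral_congr_fun (measurableSet_openSimplex _) fun x hx => ?_
      simp only [rightEnd_last, H]
      congr 2
      funext i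
      have hpos : 0 < ∑ l, x l := Finset.sum_pos (fun i _ => hx.1 i) Finset.univ_nonempty
      induction i using Fin.lastCases with
      | last =>
        rw [rightEnd_div, rightEnd_last, div_self hpos.ne', Fin.snoc_last]
        exact AddCircle.coe_period 1
      | cast i => rw [rightEnd_div, Fin.snoc_castSucc]
    rw [h2, h, ← mul_assoc, ENNReal.mul_inv_cancel (by simp) (by finiteness), one_mul]
  · exact Measurable.mul (by fun_prop) (hH.comp (measurable_pi_lambda _ fun i => by fun_prop))

/-! ### Symmetry and rotation invariance of the equilibrium probability. -/

theorem ownedArc_comp_perm {n : ℕ} (c : Fin n → UnitAddCircle) (σ : Equiv.Perm (Fin n))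
    (i : Fin n) : ownedArc (c ∘ σ) i = ownedArc c (σ i) := by
  refine le_antisymm ((le_ownedArc_iff _ _ _).2 fun j => ?_)
    ((le_ownedArc_iff _ _ _).2 fun j => ownedArc_le c (σ i) (σ j))
  simpa using ownedArc_le (c ∘ σ) i (σ.symm j)

theorem ownedArc_add_right {n : ℕ} (c : Fin n → UnitAddCircle) (a : UnitAddCircle) (i : Fin n) :
    ownedArc (fun j => c j + a) i = ownedArc c i := by
  simp only [ownedArc, clockwiseDist_add_right]

theorem nonImprovingSet_comp_perm {n : ℕ} (c : Fin n → UnitAddCircle) (σ : Equiv.Perm (Fin n))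
    (i : Fin n) : nonImprovingSet (c ∘ σ) i = nonImprovingSet c (σ i) := by
  ext y
  have h : Function.update (c ∘ σ) i y = Function.update c (σ i) y ∘ σ :=
    (Function.update_comp_eq_of_injective c σ.injective i y).symm
  change ownedArc (Function.update (c ∘ σ) i y) i ≤ ownedArc (c ∘ σ) i ↔
    ownedArc (Function.update c (σ i) y) (σ i) ≤ ownedArc c (σ i)
  rw [h, ownedArc_comp_perm, ownedArc_comp_perm]

theorem nonImprovingSet_add_right {n : ℕ} (c : Fin n → UnitAddCircle) (a : UnitAddCircle)
    (i : Fin n) :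
    nonImprovingSet (fun j => c j + a) i = (fun y => y + -a) ⁻¹' nonImprovingSet c i := by
  ext y
  have h : Function.update (fun j => c j + a) i y =
      fun j => Function.update c i (y + -a) j + a := by
    funext j
    by_cases hj : j = i
    · subst hj; simp
    · simp [hj]
  change ownedArc (Function.update (fun j => c j + a) i y) i ≤ ownedArc (fun j => c j + a) i ↔
    ownedArc (Function.update c i (y + -a)) i ≤ ownedArc c i
  rw [h, ownedArc_add_right, ownedArc_add_right]

/-- The probability that the profile with chosen points `c` is an equilibrium when every player
has `k` further points that are uniform and independent. -/
noncomputable def equilibriumProb {n : ℕ} (k : ℕ) (c : Fin n → UnitAddCircle) : ℝ≥0∞ :=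
  ∏ i, volume (nonImprovingSet c i) ^ k

theorem measurable_equilibriumProb {n : ℕ} (k : ℕ) :
    Measurable (equilibriumProb (n := n) k) := by
  have h : ∀ i : Fin n, Measurable fun c : Fin n → UnitAddCircle =>
      volume (nonImprovingSet c i) := fun i =>
    measurable_measure_prodMk_left (measurableSet_nonImproving i)
  unfold equilibriumProb
  fun_prop

theorem equilibriumProb_comp_perm {n : ℕ} (k : ℕ) (σ : Equiv.Perm (Fin n))
    (c : Fin n → UnitAddCircle) : equilibriumProb k (c ∘ σ) = equilibriumProb k c := by
  simp only [equilibriumProb, nonImprovingSet_comp_perm]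
  exact Equiv.prod_comp σ fun i => volume (nonImprovingSet c i) ^ k

theorem equilibriumProb_add_right {n : ℕ} (k : ℕ) (c : Fin n → UnitAddCircle)
    (a : UnitAddCircle) : equilibriumProb k (fun i => c i + a) = equilibriumProb k c := by
  simp only [equilibriumProb, nonImprovingSet_add_right, measure_preimage_add_right]

theorem minSum_div {n : ℕ} {x : Fin n → ℝ} {r : ℝ} (hr : 0 < r) (i : Fin n) :
    minSum (fun j => x j / r) i = minSum x i / r := by
  simp only [minSum, min_div_div_right hr.le, Finset.sum_div]

/-! ### Bounds for the probability of one profile. -/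

section Bounds

variable {N : ℕ} (k : ℕ)

/-- `equilibriumProb` in terms of the lengths of the arcs, on a circle of any circumference. -/
theorem le_ofReal_pow_mul_equilibriumProb_le {x : Fin (N + 1) → ℝ} (hx : ∀ i, 0 < x i) :
    ∏ i, ENNReal.ofReal (minSum x (i + 1) - min (x (i + 1)) (x i)) ^ k ≤
        ENNReal.ofReal (∑ i, x i) ^ ((N + 1) * k) *
          equilibriumProb k (fun i => (rightEnd (fun j => x j / ∑ l, x l) i : UnitAddCircle)) ∧
      ENNReal.ofReal (∑ i, x i) ^ ((N + 1) * k) *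
          equilibriumProb k (fun i => (rightEnd (fun j => x j / ∑ l, x l) i : UnitAddCircle)) ≤
        ∏ i, ENNReal.ofReal (minSum x i) ^ k := by
  set r := ∑ i, x i with hr
  have hpos : 0 < r := Finset.sum_pos (fun i _ => hx i) Finset.univ_nonempty
  have hx' : ∀ i, 0 < x i / r := fun i => div_pos (hx i) hpos
  have hx1 : ∑ i, x i / r = 1 := by rw [← Finset.sum_div, ← hr, div_self hpos.ne']
  have hprod : ENNReal.ofReal r ^ ((N + 1) * k) *
      equilibriumProb k (fun i => (rightEnd (fun j => x j / r) i : UnitAddCircle)) =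
      ∏ i, (ENNReal.ofReal r * volume (nonImprovingSet
        (fun i => (rightEnd (fun j => x j / r) i : UnitAddCircle)) i)) ^ k := by
    simp only [mul_pow, Finset.prod_mul_distrib, equilibriumProb]
    congr 1
    simp [mul_comm (N + 1) k, pow_mul]
  rw [hprod]
  constructor
  · refine Finset.prod_le_prod' fun i _ => pow_le_pow_left₀ zero_le ?_ k
    refine le_trans (le_of_eq ?_) (mul_le_mul_right (le_volume_nonImprovingSet hx' hx1 i) _)
    rw [← ENNReal.ofReal_mul hpos.le, minSum_div hpos, min_div_div_right hpos.le]
    congr 1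
    field_simp
  · rw [← Equiv.prod_comp (Equiv.addRight (1 : Fin (N + 1))) fun i => ENNReal.ofReal (minSum x i) ^ k]
    refine Finset.prod_le_prod' fun i _ => pow_le_pow_left₀ zero_le ?_ k
    refine (mul_le_mul_right (volume_nonImprovingSet_le hx' hx1 i) _).trans_eq ?_
    rw [← ENNReal.ofReal_mul hpos.le, minSum_div hpos]
    simp only [Equiv.coe_addRight]
    congr 1
    field_simp

/-- The weight exponent (N + 1) * k is the degree of a product of N + 1 lengths to the power k. It
cancels the normalization by the total, so the bounds can be stated with the raw lengths x. -/
theorem lintegral_equilibriumProb :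
    ∫⁻ c : Fin (N + 1) → UnitAddCircle, equilibriumProb k c =
      (k + 1) * ((N + 1).factorial * ∫⁻ x in openSimplex (N + 1),
        ENNReal.ofReal (∑ i, x i) ^ ((N + 1) * k) *
          equilibriumProb k fun i => (rightEnd (fun j => x j / ∑ l, x l) i : UnitAddCircle)) := by
  rw [lintegral_circle_eq_setLIntegral_openSimplex ((N + 1) * k) (measurable_equilibriumProb k)
    (equilibriumProb_add_right k) (equilibriumProb_comp_perm k), ← mul_assoc, ← mul_assoc]
  congr 1
  -- With K = (N + 1) * k the radial factor N + K + 1 is (N + 1) * (k + 1), and N + 1 completes the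
  -- factorial.
  rw [Nat.factorial_succ]
  push_cast
  ring

theorem lintegral_equilibriumProb_le :
    ∫⁻ c : Fin (N + 1) → UnitAddCircle, equilibriumProb k c ≤
      (k + 1) * ((k : ℝ≥0∞) + 1)⁻¹ ^ (N + 1) := by
  rw [lintegral_equilibriumProb, ← factorial_mul_setLIntegral_prod_minSum]
  gcongr _ * (_ * ?_)
  exact setLIntegral_mono' (measurableSet_openSimplex _) fun x hx =>
    (le_ofReal_pow_mul_equilibriumProb_le k hx.1).2

theorem equilibriumProb_fin_one (c : Fin 1 → UnitAddCircle) : equilibriumProb k c = 1 := by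
  have h : ∀ c : Fin 1 → UnitAddCircle, ∀ i, ownedArc c i = 1 := fun c i => by
    obtain ⟨j, hj⟩ := exists_clockwiseDist_eq_ownedArc c i
    rw [hj, Subsingleton.elim j i, clockwiseDist_self]
  have h2 : ∀ i, nonImprovingSet c i = Set.univ := fun i => by
    ext y; simp [nonImprovingSet, h]
  simp [equilibriumProb, h2]

theorem le_lintegral_equilibriumProb :
    (1 / 4) ^ k * ((k + 1) * ((k : ℝ≥0∞) + 1)⁻¹ ^ (N + 1)) ≤
      ∫⁻ c : Fin (N + 1) → UnitAddCircle, equilibriumProb k c := by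
  cases N with
  | zero =>
    -- A single player always owns the whole circle. The case is separate because an arc that is its
    -- own predecessor makes the general lower bound for the volume 0.
    simp only [zero_add, equilibriumProb_fin_one, pow_one]
    rw [ENNReal.mul_inv_cancel (by simp) (by finiteness), lintegral_one, volume_pi,
      Measure.pi_univ, mul_one]
    simpa using pow_le_one' (ENNReal.inv_le_one.2 (by norm_num : (1 : ℝ≥0∞) ≤ 4)) k
  | succ N =>
    rw [lintegral_equilibriumProb, ← factorial_mul_setLIntegral_prod_minSum, mul_left_comm,
      mul_left_comm ((1 / 4 : ℝ≥0∞) ^ k)]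
    gcongr _ * (_ * ?_)
    exact (setLIntegral_prod_minSum_le N k).trans
      (setLIntegral_mono' (measurableSet_openSimplex _) fun x hx =>
        (le_ofReal_pow_mul_equilibriumProb_le k hx.1).1)

end Bounds

/-! ### The expected number of equilibria as an integral over the chosen points. -/

section Nash

variable {n m : ℕ}

/-- Leaving out the trivial deviation k = s i turns equilibrium, for fixed chosen points, into a
separate condition on each unchosen point. This is what makes the conditional probability a product.
-/
theorem isPureNash_oneWayUtility_iff (p : Fin n → Fin m → UnitAddCircle) (s : Fin n → Fin m) :
    IsPureNash (oneWayUtility p) s ↔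
      ∀ i k, k ≠ s i → p i k ∈ nonImprovingSet (fun j => p j (s j)) i := by
  have h : ∀ i k, oneWayUtility p (Function.update s i k) i =
      ownedArc (Function.update (fun j => p j (s j)) i (p i k)) i := by
    intro i k
    unfold oneWayUtility
    congr 1
    funext j
    by_cases hj : j = i
    · subst hj; simp
    · simp [hj]
  refine forall_congr' fun i => forall_congr' fun k => ?_
  rw [h]
  refine ⟨fun h1 _ => h1, fun h1 => ?_⟩
  by_cases hk : k = s i
  · subst hk
    rw [Function.update_eq_self i (fun j => p j (s j))]
    exact le_rfl
  · exact h1 hk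

theorem measurableSet_isPureNash (s : Fin n → Fin m) :
    MeasurableSet {p : Fin n × Fin m → UnitAddCircle |
      IsPureNash (oneWayUtility fun i k => p (i, k)) s} := by
  have : {p : Fin n × Fin m → UnitAddCircle |
      IsPureNash (oneWayUtility fun i k => p (i, k)) s} = ⋂ i, ⋂ k,
        {p | oneWayUtility (fun i k => p (i, k)) (Function.update s i k) i ≤
          oneWayUtility (fun i k => p (i, k)) s i} := by
    ext p; simp [IsPureNash]
  rw [this]
  have h : ∀ (s : Fin n → Fin m) i, Measurable fun p : Fin n × Fin m → UnitAddCircle =>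
      oneWayUtility (fun i k => p (i, k)) s i := fun s i =>
    (measurable_ownedArc i).comp (measurable_pi_lambda _ fun j => measurable_pi_apply (j, s j))
  exact MeasurableSet.iInter fun i => MeasurableSet.iInter fun k => measurableSet_le (h _ i) (h _ i)

/-- The probability that a given profile is an equilibrium. -/
theorem volume_isPureNash (s : Fin n → Fin m) :
    volume {p : Fin n × Fin m → UnitAddCircle |
      IsPureNash (oneWayUtility fun i k => p (i, k)) s} =
      ∫⁻ c : Fin n → UnitAddCircle, equilibriumProb (m - 1) c := by
  classical
  -- The coordinates are split into chosen and unchosen ones; slices over the chosen ones are boxes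
  -- with m - 1 factors for each player.
  let chosen : Fin n × Fin m → Prop := fun q => q.2 = s q.1
  let e : {q // chosen q} ≃ Fin n :=
    { toFun := fun q => q.1.1
      invFun := fun i => ⟨(i, s i), rfl⟩
      left_inv := fun q => Subtype.ext (Prod.ext rfl q.2.symm)
      right_inv := fun _ => rfl }
  have hsplit := volume_preserving_piEquivPiSubtypeProd (fun _ : Fin n × Fin m => UnitAddCircle)
    chosen
  have hchosen := volume_measurePreserving_piCongrLeft (fun _ : Fin n => UnitAddCircle) e
  let T := MeasurableEquiv.piCongrLeft (fun _ : Fin n => UnitAddCircle) e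
  have hT : ∀ (a : {q // chosen q} → UnitAddCircle) i, T a i = a ⟨(i, s i), rfl⟩ := fun a i =>
    MeasurableEquiv.piCongrLeft_apply_apply (β := fun _ : Fin n => UnitAddCircle) e a
      ⟨(i, s i), rfl⟩
  let S : Set (({q // chosen q} → UnitAddCircle) × ({q // ¬chosen q} → UnitAddCircle)) :=
    {z | ∀ q, z.2 q ∈ nonImprovingSet (T z.1) q.1.1}
  have hS : MeasurableSet S := by
    have : S = ⋂ q, {z | z.2 q ∈ nonImprovingSet (T z.1) q.1.1} := by ext; simp [S]
    rw [this]
    refine MeasurableSet.iInter fun q => ?_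
    have hm : Measurable fun z : ({q // chosen q} → UnitAddCircle) ×
        ({q // ¬chosen q} → UnitAddCircle) => (T z.1, z.2 q) :=
      (T.measurable.comp measurable_fst).prodMk ((measurable_pi_apply q).comp measurable_snd)
    exact hm (measurableSet_nonImproving q.1.1)
  have hpre : {p : Fin n × Fin m → UnitAddCircle |
      IsPureNash (oneWayUtility fun i k => p (i, k)) s} =
      MeasurableEquiv.piEquivPiSubtypeProd (fun _ : Fin n × Fin m => UnitAddCircle) chosen ⁻¹'
        S := by
    ext p
    have hc : T (MeasurableEquiv.piEquivPiSubtypeProd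
        (fun _ : Fin n × Fin m => UnitAddCircle) chosen p).1 = fun j => p (j, s j) := by
      funext i; rw [hT]; rfl
    change IsPureNash (oneWayUtility fun i k => p (i, k)) s ↔ ∀ q : {q // ¬chosen q},
      p q.1 ∈ nonImprovingSet (T (MeasurableEquiv.piEquivPiSubtypeProd
        (fun _ : Fin n × Fin m => UnitAddCircle) chosen p).1) q.1.1
    rw [isPureNash_oneWayUtility_iff, hc]
    exact ⟨fun h q => h q.1.1 q.1.2 q.2, fun h i k hk => h ⟨(i, k), hk⟩⟩
  have hslice : ∀ a, volume (Prod.mk a ⁻¹' S) = equilibriumProb (m - 1) (T a) := by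
    intro a
    have h1 : Prod.mk a ⁻¹' S = Set.univ.pi fun q : {q // ¬chosen q} =>
        nonImprovingSet (T a) q.1.1 := by
      ext b; simp [S]
    rw [h1, volume_pi_pi, equilibriumProb]
    rw [← Finset.prod_subtype (Finset.univ.filter fun q : Fin n × Fin m => ¬chosen q)
      (p := fun q => ¬chosen q) (by simp) fun q => volume (nonImprovingSet (T a) q.1),
      Finset.prod_filter, Fintype.prod_prod_type]
    refine Finset.prod_congr rfl fun i _ => ?_
    rw [← Finset.prod_filter]
    refine (Finset.prod_const (volume (nonImprovingSet (T a) i))).trans ?_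
    congr 1
    have h3 : (Finset.univ.filter fun k : Fin m => ¬chosen (i, k)) = Finset.univ.erase (s i) := by
      ext k; simp [chosen]
    rw [h3, Finset.card_erase_of_mem (Finset.mem_univ _), Finset.card_univ, Fintype.card_fin]
  rw [hpre, hsplit.measure_preimage hS.nullMeasurableSet, Measure.volume_eq_prod,
    Measure.prod_apply hS, lintegral_congr hslice]
  exact hchosen.lintegral_comp (measurable_equilibriumProb (m - 1))

theorem numPureNash_eq_sum (p : Fin n × Fin m → UnitAddCircle) :
    (numPureNash (fun i k => p (i, k)) : ℝ) = ∑ s : Fin n → Fin m,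
      {p : Fin n × Fin m → UnitAddCircle |
        IsPureNash (oneWayUtility fun i k => p (i, k)) s}.indicator (fun _ => (1 : ℝ)) p := by
  classical
  rw [numPureNash, Set.ncard_eq_toFinset_card', Set.toFinset_ofPred, Finset.card_filter,
    Nat.cast_sum]
  refine Finset.sum_congr rfl fun s _ => ?_
  by_cases h : IsPureNash (oneWayUtility fun i k => p (i, k)) s
  · rw [Set.indicator_of_mem (by exact h), if_pos h, Nat.cast_one]
  · rw [Set.indicator_of_notMem (by exact h), if_neg h, Nat.cast_zero]

theorem integrable_numPureNash :
    Integrable fun p : Fin n × Fin m → UnitAddCircle =>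
      (numPureNash (fun i k => p (i, k)) : ℝ) := by
  simp only [numPureNash_eq_sum]
  exact integrable_finsetSum _ fun s _ =>
    (integrable_const 1).indicator (measurableSet_isPureNash s)

theorem integral_numPureNash :
    ∫ p : Fin n × Fin m → UnitAddCircle, (numPureNash (fun i k => p (i, k)) : ℝ) =
      (m : ℝ) ^ n * (∫⁻ c : Fin n → UnitAddCircle, equilibriumProb (m - 1) c).toReal := by
  simp only [numPureNash_eq_sum]
  rw [integral_finsetSum _ fun s _ =>
    (integrable_const 1).indicator (measurableSet_isPureNash s)]
  simp only [integral_indicator_const _ (measurableSet_isPureNash _), Measure.real,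
    volume_isPureNash]
  simp

end Nash

/-! ### Transfer to the given random points and conclusion. -/

theorem mainTheorem1 {Ω : Type*} [MeasurableSpace Ω] (P : Measure Ω) [IsProbabilityMeasure P]
    (n m : ℕ) (hn : 1 ≤ n) (hm : 1 ≤ m)
    (X : Fin n → Fin m → Ω → UnitAddCircle)
    (hunif : ∀ i k, HasLaw (X i k) (volume : Measure UnitAddCircle) P)
    (hindep : iIndepFun (fun q : Fin n × Fin m => X q.1 q.2) P) :
    Integrable (fun ω => (numPureNash (fun i k => X i k ω) : ℝ)) P ∧
      (0.19 : ℝ) ^ (m - 1) * (m : ℝ) ≤ ∫ ω, (numPureNash (fun i k => X i k ω) : ℝ) ∂P ∧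
      ∫ ω, (numPureNash (fun i k => X i k ω) : ℝ) ∂P ≤ (m : ℝ) := by
  obtain ⟨N, rfl⟩ := Nat.exists_eq_add_of_le' hn
  obtain ⟨k, rfl⟩ := Nat.exists_eq_add_of_le' hm
  -- Independence and uniformity make the joint law the product measure, on which everything above
  -- was computed.
  have hlaw : HasLaw (fun ω (q : Fin (N + 1) × Fin (k + 1)) => X q.1 q.2 ω) volume P :=
    hindep.hasLaw_pi fun q => hunif q.1 q.2
  have hint := integrable_numPureNash (n := N + 1) (m := k + 1)
  have hval : ∫ ω, (numPureNash (fun i k => X i k ω) : ℝ) ∂P =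
      ((k + 1 : ℕ) : ℝ) ^ (N + 1) *
        (∫⁻ c : Fin (N + 1) → UnitAddCircle, equilibriumProb k c).toReal := by
    have h := integral_numPureNash (n := N + 1) (m := k + 1)
    rw [Nat.add_sub_cancel] at h
    rw [← h]
    exact hlaw.integral_comp hint.aestronglyMeasurable
  set I := ∫⁻ c : Fin (N + 1) → UnitAddCircle, equilibriumProb k c with hI
  have hk : (0 : ℝ) < k + 1 := by positivity
  have htop : (k + 1) * ((k : ℝ≥0∞) + 1)⁻¹ ^ (N + 1) ≠ ∞ :=
    ENNReal.mul_ne_top (by finiteness) (ENNReal.pow_ne_top (ENNReal.inv_ne_top.2 (by simp)))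
  have hup := lintegral_equilibriumProb_le (N := N) k
  have hlow := le_lintegral_equilibriumProb (N := N) k
  have hbase : ((k + 1) * ((k : ℝ≥0∞) + 1)⁻¹ ^ (N + 1)).toReal =
      ((k : ℝ) + 1) * ((k : ℝ) + 1)⁻¹ ^ (N + 1) := by
    rw [ENNReal.toReal_mul, ENNReal.toReal_pow, ENNReal.toReal_inv,
      ENNReal.toReal_add (by finiteness) (by finiteness)]
    simp
  have hup' := ENNReal.toReal_mono htop hup
  have hlow' := ENNReal.toReal_mono (ne_top_of_le_ne_top htop hup) hlow
  rw [ENNReal.toReal_mul, hbase, ENNReal.toReal_pow, ENNReal.toReal_div] at hlow'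
  rw [hbase] at hup'
  -- The m ^ n profiles cancel the mean (k + 1)^(-n), leaving the single factor k + 1 = m.
  have hcancel : ∀ a : ℝ, ((k : ℝ) + 1) ^ (N + 1) * (a * (((k : ℝ) + 1) *
      ((k : ℝ) + 1)⁻¹ ^ (N + 1))) = a * (k + 1) := by
    intro a
    rw [inv_pow]
    field_simp
  have hpow : (0 : ℝ) ≤ ((k : ℝ) + 1) ^ (N + 1) := by positivity
  refine ⟨?_, ?_, ?_⟩
  · have h := hint
    rw [← hlaw.map_eq] at h
    exact h.comp_aemeasurable hlaw.aemeasurable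
  · rw [hval, Nat.add_sub_cancel]
    push_cast
    refine le_trans ?_ (mul_le_mul_of_nonneg_left hlow' hpow)
    rw [hcancel]
    -- What remains is 0.19 ≤ 1/4.
    gcongr
    norm_num
  · rw [hval]
    push_cast
    refine (mul_le_mul_of_nonneg_left hup' hpow).trans_eq ?_
    have := hcancel 1
    rwa [one_mul, one_mul] at this
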